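/- **Conventions.** For a semi-Riemannian metric $g$ on an $N$-manifold, a smooth function $\phi$ and $\lambda\in\mathbb R$ put $$P_\phi=\mathrm{Ric}+\nabla^2\phi-\lambda g,\quad F_\phi=\Delta\phi-|\nabla\phi|^2+2\lambda\phi-N\lambda,\quad v_{1,\phi}=\tfrac12\big(R+2\Delta\phi-|\nabla\phi|^2+2\lambda(\phi-N)\big).$$ Let $M$ be a smooth $n$-manifold. A *normal global weighted ambient space* $(\widetilde{\mathcal G},\widetilde g,\widetilde\phi,\lambda)$ over $M$ consists of an open set $\widetilde{\mathcal G}\subset\mathbb R\times M\times\mathbb R$ (points $(v,x,u)$) containing $\{u=0\}$, such that for all $(v,x)$ the set $\{u:(v,x,u)\in\widetilde{\mathcal G}\}$ is an interval and such that the dilations $\delta_t(v,x,u)=(v+(\lambda u-1)^{-1}t,x,u)$ are defined on $\widetilde{\mathcal G}$ (i.e. $\lambda u\ne1$ there) and preserve it, together with smooth $$\widetilde g=2\,du\,dv+g_u,\qquad \widetilde\phi=\phi_u-v+\lambda uv,$$ with $g_u$ a family of Riemannian metrics and $\phi_u$ a family of functions on (open subsets of) $M$, satisfying $\widetilde P_{\phi}=0$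 and $\widetilde F_{\phi}=0$ on $\widetilde{\mathcal G}$ (here $N=n+2$). **Theorem.** Let $\tau>0$, $\varepsilon>0$, and let $(\widetilde{\mathcal G},\widetilde g,\widetilde\phi,(2\tau)^{-1})$ be a normal global weighted ambient space over $M$ with families $g_u,\phi_u$. For $s\in(-\varepsilon,\tau)$ put $\tau(s)=(1-s/\tau)\tau$, $\lambda(s)=(2\tau(s))^{-1}$, $u(s)=(1-s/\tau)u$ and $$g_{u(s)}(s)=(1-s/\tau)\,g_u,\qquad \phi_{u(s)}(s)=\phi_u,\qquad \widetilde\phi(s)=\phi_{u(s)}(s)-v+\lambda(s)u(s)v,\qquad \widetilde g(s)=2\,du(s)\,dv+g_{u(s)}(s).$$ Then for each $s$ the normal coordinates $(v,x,u(s))$ and $\widetilde g(s),\widetilde\phi(s),\lambda(s)$ define a normal global weighted ambient space. On $\widetilde{\mathcal G}\times(-\varepsilon,\tau)$, with coordinates $(v,x^i,u,s)$, consider the vector field $$Y=\big(1-\lambda(s)u(s)\big)^{-1}(v_{1,\phi})_{u(s)}\,\partial_v-\big(1-\lambda(s)u(s)\big)\,\partial_{u(s)}+\partial_s ,\qquad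 \partial_{u(s)}=(1-s/\tau)^{-1}\partial_u ,$$ where $\partial_s$ is taken at fixed $(v,x,u)$. Write $g=g_{u(s)}(s)$ (a tensor on the product that annihilates $\partial_v,\partial_u,\partial_s$), $\phi=\widetilde\phi(s)$ and $\tau=\tau(s)$ for the resulting tensor and functions on $\widetilde{\mathcal G}\times(-\varepsilon,\tau)$, where $\mathrm{Ric}$, $R$, $\nabla^2\phi$, $\Delta\phi$ and $(v_{1,\phi})_{u(s)}$ are those of $(g_{u(s)}(s),\ \widetilde\phi(s)(v,\cdot,u(s)),\ \lambda(s))$ on $M$ at fixed $v,u,s$ (so $N=n$ in $v_{1,\phi}$). Then at every point the $\mathcal W$-gradient Ricci flow equations hold along $Y$: $$L_Yg=-2(\mathrm{Ric}+\nabla^2\phi),\qquad L_Y\phi=-R-\Delta\phi+\frac{n}{2\tau},\qquad L_Y\tau=-1.$$ (The right-hand side of the first equation is extended by zero to $\partial_v,\partial_u,\partial_s$.) -/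

import Mathlib

open scoped Manifold ContDiff

noncomputable section

namespace WeightedAmbient

/-! ### Coordinate formulas on a finite-dimensional vector space `E` with a basis `b` -/

section Coordinates

variable {ι E : Type*} [Fintype ι] [DecidableEq ι] [NormedAddCommGroup E] [NormedSpace ℝ E]

/-- The partial derivative `∂ᵢ f`. -/
def pd (b : Module.Basis ι ℝ E) (i : ι) (f : E → ℝ) (y : E) : ℝ := fderiv ℝ f y (b i)

/-- The Christoffel symbols `Γᵏᵢⱼ = ½ gᵏˡ (∂ᵢ gⱼₗ + ∂ⱼ gᵢₗ - ∂ₗ gᵢⱼ)` of a field `G` of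
nondegenerate symmetric matrices (of any signature). -/
def christoffel (b : Module.Basis ι ℝ E) (G : E → Matrix ι ι ℝ) (k i j : ι) (y : E) : ℝ :=
  (1 / 2) * ∑ l, (G y)⁻¹ k l *
    (pd b i (fun z => G z j l) y + pd b j (fun z => G z i l) y - pd b l (fun z => G z i j) y)

/-- The components of the Ricci tensor:
`Rᵢⱼ = ∂ₖ Γᵏᵢⱼ - ∂ⱼ Γᵏᵢₖ + Γᵏₖₗ Γˡᵢⱼ - Γᵏⱼₗ Γˡᵢₖ`. -/
def ricciCoord (b : Module.Basis ι ℝ E) (G : E → Matrix ι ι ℝ) (i j : ι) (y : E) : ℝ :=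
  ∑ k, pd b k (christoffel b G k i j) y - ∑ k, pd b j (christoffel b G k i k) y
    + ∑ k, ∑ l, (christoffel b G k k l y * christoffel b G l i j y
        - christoffel b G k j l y * christoffel b G l i k y)

/-- The components of the Hessian: `∇ᵢ∇ⱼ f = ∂ᵢ∂ⱼ f - Γᵏᵢⱼ ∂ₖ f`. -/
def hessCoord (b : Module.Basis ι ℝ E) (G : E → Matrix ι ι ℝ) (f : E → ℝ) (i j : ι) (y : E) : ℝ :=
  pd b i (pd b j f) y - ∑ k, christoffel b G k i j y * pd b k f y

end Coordinates

/-! ### Tensors on manifolds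

The tangent space at `p` is the model vector space `E`, identified with it through the preferred
chart at `p`; a basis `b` of `E` is therefore the coordinate basis at `p` of that chart.  All
tensors below are evaluated at `p` in the preferred chart at `p`.  Manifolds have no boundary
and no corners here: the models used are `𝓡 n`, `𝓘(ℝ, ℝ)` and their products. -/

section Manifold

variable {ι E H N : Type*} [Fintype ι] [DecidableEq ι] [NormedAddCommGroup E] [NormedSpace ℝ E]
  [TopologicalSpace H] [TopologicalSpace N] [ChartedSpace H N]

/-- A field of bilinear forms on the tangent spaces. -/
abbrev TwoTensor (I : ModelWithCorners ℝ E H) (N : Type*) [TopologicalSpace N]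
    [ChartedSpace H N] : Type _ :=
  (p : N) → LinearMap.BilinForm ℝ (TangentSpace I p)

/-- The coordinate vector field `∂ᵢ` of the chart at `p`, at the point `q` with coordinates `y`.
As `T_q N` is `E` through the chart at `q`, this is the derivative at `y` of the transition map
from the chart at `p` to the chart at `q`, applied to `b i`. -/
def coordVector (I : ModelWithCorners ℝ E H) (b : Module.Basis ι ℝ E) (p : N) (i : ι) (y : E) :
    TangentSpace I ((extChartAt I p).symm y) :=
  (fderiv ℝ (fun z => extChartAt I ((extChartAt I p).symm y) ((extChartAt I p).symm z)) y (b i) : E)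

/-- The component matrix of a 2-tensor in the chart at `p`. -/
def coordTensor (I : ModelWithCorners ℝ E H) (b : Module.Basis ι ℝ E) (h : TwoTensor I N) (p : N)
    (y : E) : Matrix ι ι ℝ :=
  Matrix.of fun i j => h _ (coordVector I b p i y) (coordVector I b p j y)

/-- A function read in the chart at `p`. -/
def coordFun (I : ModelWithCorners ℝ E H) (f : N → ℝ) (p : N) (y : E) : ℝ :=
  f ((extChartAt I p).symm y)

/-- The components of a vector field in the chart at `p`, at the point `q` with coordinates `y`;
the vector at `q`, an element of `E` through the chart at `q`, is taken to the chart at `p`. -/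
def coordField (I : ModelWithCorners ℝ E H) (b : Module.Basis ι ℝ E)
    (Y : (q : N) → TangentSpace I q) (p : N) (k : ι) (y : E) : ℝ :=
  b.repr (fderiv ℝ (fun z => extChartAt I p ((extChartAt I ((extChartAt I p).symm y)).symm z))
    (extChartAt I ((extChartAt I p).symm y) ((extChartAt I p).symm y))
    (Y ((extChartAt I p).symm y) : E)) k

/-- The bilinear form on the tangent space at `p` with components `c` in the basis `b`. -/
def evalComponents (I : ModelWithCorners ℝ E H) (b : Module.Basis ι ℝ E) (p : N) (c : ι → ι → ℝ)
    (X Y : TangentSpace I p) : ℝ :=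
  ∑ i, ∑ j, c i j * b.repr (X : E) i * b.repr (Y : E) j

/-- A 2-tensor is smooth on `S` if its components in charts are. -/
def IsSmoothOn (I : ModelWithCorners ℝ E H) (b : Module.Basis ι ℝ E) (h : TwoTensor I N)
    (S : Set N) : Prop :=
  ∀ p : N, ∀ i j : ι, ContDiffOn ℝ ∞ (fun y => coordTensor I b h p y i j)
    ((extChartAt I p).target ∩ (extChartAt I p).symm ⁻¹' S)

/-- The Ricci tensor of the metric `h`. -/
def ricci (I : ModelWithCorners ℝ E H) (b : Module.Basis ι ℝ E) (h : TwoTensor I N) (p : N)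
    (X Y : TangentSpace I p) : ℝ :=
  evalComponents I b p
    (fun i j => ricciCoord b (coordTensor I b h p) i j (extChartAt I p p)) X Y

/-- The Hessian `∇² f`. -/
def hess (I : ModelWithCorners ℝ E H) (b : Module.Basis ι ℝ E) (h : TwoTensor I N) (f : N → ℝ)
    (p : N) (X Y : TangentSpace I p) : ℝ :=
  evalComponents I b p
    (fun i j => hessCoord b (coordTensor I b h p) (coordFun I f p) i j (extChartAt I p p)) X Y

/-- The scalar curvature `R`. -/
def scalar (I : ModelWithCorners ℝ E H) (b : Module.Basis ι ℝ E) (h : TwoTensor I N) (p : N) : ℝ :=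
  ∑ i, ∑ j, (coordTensor I b h p (extChartAt I p p))⁻¹ i j *
    ricciCoord b (coordTensor I b h p) i j (extChartAt I p p)

/-- The Laplacian `Δ f`, the trace of the Hessian. -/
def laplacian (I : ModelWithCorners ℝ E H) (b : Module.Basis ι ℝ E) (h : TwoTensor I N)
    (f : N → ℝ) (p : N) : ℝ :=
  ∑ i, ∑ j, (coordTensor I b h p (extChartAt I p p))⁻¹ i j *
    hessCoord b (coordTensor I b h p) (coordFun I f p) i j (extChartAt I p p)

/-- The squared length `|∇ f|²` of the gradient. -/
def gradSq (I : ModelWithCorners ℝ E H) (b : Module.Basis ι ℝ E) (h : TwoTensor I N) (f : N → ℝ)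
    (p : N) : ℝ :=
  ∑ i, ∑ j, (coordTensor I b h p (extChartAt I p p))⁻¹ i j *
    pd b i (coordFun I f p) (extChartAt I p p) * pd b j (coordFun I f p) (extChartAt I p p)

/-- `Ric_φ = Ric + ∇² φ`. -/
def weightedRicci (I : ModelWithCorners ℝ E H) (b : Module.Basis ι ℝ E) (h : TwoTensor I N)
    (φ : N → ℝ) (p : N) (X Y : TangentSpace I p) : ℝ :=
  ricci I b h p X Y + hess I b h φ p X Y

/-- `P_φ = Ric_φ - λ g`. -/
def weightedP (I : ModelWithCorners ℝ E H) (b : Module.Basis ι ℝ E) (h : TwoTensor I N)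
    (φ : N → ℝ) (lam : ℝ) (p : N) (X Y : TangentSpace I p) : ℝ :=
  weightedRicci I b h φ p X Y - lam * h p X Y

/-- `F_φ = Δ φ - |∇ φ|² + 2 λ φ - (dim) λ`. -/
def weightedF (I : ModelWithCorners ℝ E H) (b : Module.Basis ι ℝ E) (h : TwoTensor I N)
    (φ : N → ℝ) (lam : ℝ) (p : N) : ℝ :=
  laplacian I b h φ p - gradSq I b h φ p + 2 * lam * φ p - Fintype.card ι * lam

/-- `R_φ = R + 2 Δ φ - |∇ φ|² + 2 λ (φ - dim)`. -/
def weightedScalar (I : ModelWithCorners ℝ E H) (b : Module.Basis ι ℝ E) (h : TwoTensor I N)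
    (φ : N → ℝ) (lam : ℝ) (p : N) : ℝ :=
  scalar I b h p + 2 * laplacian I b h φ p - gradSq I b h φ p
    + 2 * lam * (φ p - Fintype.card ι)

/-- `v_{1,φ} = ½ R_φ`. -/
def v₁ (I : ModelWithCorners ℝ E H) (b : Module.Basis ι ℝ E) (h : TwoTensor I N)
    (φ : N → ℝ) (lam : ℝ) (p : N) : ℝ :=
  (1 / 2) * weightedScalar I b h φ lam p

/-- The Lie derivative of a function. -/
def lieFun (I : ModelWithCorners ℝ E H) (Y : (q : N) → TangentSpace I q) (f : N → ℝ) (p : N) : ℝ :=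
  mfderiv I 𝓘(ℝ, ℝ) f p (Y p)

/-- The Lie derivative of a 2-tensor:
`(L_Y h)ᵢⱼ = Yᵏ ∂ₖ hᵢⱼ + hₖⱼ ∂ᵢ Yᵏ + hᵢₖ ∂ⱼ Yᵏ`. -/
def lieTensor (I : ModelWithCorners ℝ E H) (b : Module.Basis ι ℝ E)
    (Y : (q : N) → TangentSpace I q) (h : TwoTensor I N) (p : N) (A B : TangentSpace I p) : ℝ :=
  evalComponents I b p (fun i j =>
    ∑ k, (coordField I b Y p k (extChartAt I p p) *
            pd b k (fun y => coordTensor I b h p y i j) (extChartAt I p p)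
        + coordTensor I b h p (extChartAt I p p) k j *
            pd b i (coordField I b Y p k) (extChartAt I p p)
        + coordTensor I b h p (extChartAt I p p) i k *
            pd b j (coordField I b Y p k) (extChartAt I p p))) A B

end Manifold

/-! ### The spaces `M`, `ℝ × M × ℝ` (coordinates `v, x, u`) and `(ℝ × M × ℝ) × ℝ`
(coordinates `v, x, u, s`) -/

/-- The standard basis of the model space of an `n`-manifold. -/
def baseBasis (n : ℕ) : Module.Basis (Fin n) ℝ (EuclideanSpace ℝ (Fin n)) :=
  (EuclideanSpace.basisFun (Fin n) ℝ).toBasis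

/-- The model of `ℝ × M × ℝ`. -/
abbrev ambI (n : ℕ) := 𝓘(ℝ, ℝ).prod ((𝓡 n).prod 𝓘(ℝ, ℝ))

/-- The basis `∂_v, ∂_i, ∂_u`. -/
def ambBasis (n : ℕ) :
    Module.Basis (Unit ⊕ (Fin n ⊕ Unit)) ℝ (ℝ × EuclideanSpace ℝ (Fin n) × ℝ) :=
  (Module.Basis.singleton Unit ℝ).prod ((baseBasis n).prod (Module.Basis.singleton Unit ℝ))

/-- The model of `(ℝ × M × ℝ) × ℝ`. -/
abbrev totI (n : ℕ) := (ambI n).prod 𝓘(ℝ, ℝ)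

/-- The basis `∂_v, ∂_i, ∂_u, ∂_s`. -/
def totBasis (n : ℕ) :
    Module.Basis ((Unit ⊕ (Fin n ⊕ Unit)) ⊕ Unit) ℝ
      ((ℝ × EuclideanSpace ℝ (Fin n) × ℝ) × ℝ) :=
  (ambBasis n).prod (Module.Basis.singleton Unit ℝ)

/-- The linear functional `dv` on the model space of `ℝ × M × ℝ`. -/
def dv (n : ℕ) : (ℝ × EuclideanSpace ℝ (Fin n) × ℝ) →ₗ[ℝ] ℝ := LinearMap.fst ℝ _ _

/-- The linear projection `dx` from the model space of `ℝ × M × ℝ` to that of `M`. -/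
def dx (n : ℕ) : (ℝ × EuclideanSpace ℝ (Fin n) × ℝ) →ₗ[ℝ] EuclideanSpace ℝ (Fin n) :=
  LinearMap.fst ℝ _ _ ∘ₗ LinearMap.snd ℝ _ _

/-- The linear functional `du` on the model space of `ℝ × M × ℝ`. -/
def du (n : ℕ) : (ℝ × EuclideanSpace ℝ (Fin n) × ℝ) →ₗ[ℝ] ℝ :=
  LinearMap.snd ℝ _ _ ∘ₗ LinearMap.snd ℝ _ _

/-- The data of a space in normal form: a set `carrier` of points `(v, x, u)`, and families
`g_u = metric u` and `φ_u = density u` on `M`, of which only the values at `x` with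
`(v, x, u) ∈ carrier` matter. -/
structure NormalSpace (n : ℕ) (M : Type*) [TopologicalSpace M]
    [ChartedSpace (EuclideanSpace ℝ (Fin n)) M] where
  carrier : Set (ℝ × M × ℝ)
  metric : ℝ → TwoTensor (𝓡 n) M
  density : ℝ → M → ℝ

namespace NormalSpace

variable {n : ℕ} {M : Type*} [TopologicalSpace M] [ChartedSpace (EuclideanSpace ℝ (Fin n)) M]

/-- `g̃ = 2 du dv + g_u`. -/
def ambMetric (A : NormalSpace n M) : TwoTensor (ambI n) (ℝ × M × ℝ) := fun p =>
  ((LinearMap.mul ℝ ℝ).compl₁₂ (du n) (dv n) + (LinearMap.mul ℝ ℝ).compl₁₂ (dv n) (du n)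
    + LinearMap.compl₁₂ (A.metric p.2.2 p.2.1 : LinearMap.BilinForm ℝ (EuclideanSpace ℝ (Fin n)))
        (dx n) (dx n) :
    LinearMap.BilinForm ℝ (ℝ × EuclideanSpace ℝ (Fin n) × ℝ))

/-- `φ̃ = φ_u - v + λ u v`. -/
def ambDensity (A : NormalSpace n M) (lam : ℝ) : ℝ × M × ℝ → ℝ := fun p =>
  A.density p.2.2 p.2.1 - p.1 + lam * p.2.2 * p.1

/-- `(G̃, g̃, φ̃, λ)` is a normal global weighted ambient space.  The dilations are
`δ_t (v, x, u) = (v + (λ u - 1)⁻¹ t, x, u)`. -/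
structure IsGlobalAmbient (A : NormalSpace n M) (lam : ℝ) : Prop where
  isOpen_carrier : IsOpen A.carrier
  zero_mem : ∀ (v : ℝ) (x : M), (v, x, (0 : ℝ)) ∈ A.carrier
  interval : ∀ (v : ℝ) (x : M), {u : ℝ | (v, x, u) ∈ A.carrier}.OrdConnected
  dilation_defined : ∀ p ∈ A.carrier, lam * p.2.2 - 1 ≠ 0
  dilation_mem : ∀ p ∈ A.carrier, ∀ t : ℝ,
    (p.1 + (lam * p.2.2 - 1)⁻¹ * t, p.2.1, p.2.2) ∈ A.carrier
  symm : ∀ p ∈ A.carrier, ∀ X Y : TangentSpace (𝓡 n) p.2.1,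
    A.metric p.2.2 p.2.1 X Y = A.metric p.2.2 p.2.1 Y X
  pos : ∀ p ∈ A.carrier, ∀ X : TangentSpace (𝓡 n) p.2.1, X ≠ 0 → 0 < A.metric p.2.2 p.2.1 X X
  smooth_metric : IsSmoothOn (ambI n) (ambBasis n) A.ambMetric A.carrier
  smooth_density : ContMDiffOn (ambI n) 𝓘(ℝ, ℝ) ∞ (A.ambDensity lam) A.carrier
  P_eq_zero : ∀ p ∈ A.carrier, ∀ X Y : TangentSpace (ambI n) p,
    weightedP (ambI n) (ambBasis n) A.ambMetric (A.ambDensity lam) lam p X Y = 0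
  F_eq_zero : ∀ p ∈ A.carrier,
    weightedF (ambI n) (ambBasis n) A.ambMetric (A.ambDensity lam) lam p = 0

/-- The density of the manifold with density `(M, g_u, φ̃(v, ·, u), λ)` which sits in the ambient
space at constant `v` and `u`. -/
def leafDensity (A : NormalSpace n M) (lam v u : ℝ) : M → ℝ := fun x => A.ambDensity lam (v, x, u)

/-! #### The one-parameter family obtained by rescaling -/

/-- `τ(s) = (1 - s/τ) τ`. -/
def tauAt (τ s : ℝ) : ℝ := (1 - s / τ) * τ

/-- `λ(s) = (2 τ(s))⁻¹`. -/
def lamAt (τ s : ℝ) : ℝ := (2 * tauAt τ s)⁻¹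

/-- `u(s) = (1 - s/τ) u`. -/
def uAt (τ s u : ℝ) : ℝ := (1 - s / τ) * u

/-- The member with parameter `s` of the family, in its own normal coordinates `(v, x, u(s))`:
`g_{u(s)}(s) = (1 - s/τ) g_u` and `φ_{u(s)}(s) = φ_u` for `u(s) = (1 - s/τ) u`. -/
def slice (A : NormalSpace n M) (τ s : ℝ) : NormalSpace n M where
  carrier := {p | (p.1, p.2.1, p.2.2 / (1 - s / τ)) ∈ A.carrier}
  metric := fun w x => (1 - s / τ) • A.metric (w / (1 - s / τ)) x
  density := fun w x => A.density (w / (1 - s / τ)) x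

/-! On the total space, the point `((v, x, u), s)` is the point `(v, x, u(s))` of the slice with
parameter `s`. -/

/-- The (degenerate) tensor `g = g_{u(s)}(s)` on the total space. -/
def totMetric (A : NormalSpace n M) (τ : ℝ) : TwoTensor (totI n) ((ℝ × M × ℝ) × ℝ) := fun q =>
  (LinearMap.compl₁₂
      ((A.slice τ q.2).metric (uAt τ q.2 q.1.2.2) q.1.2.1 :
        LinearMap.BilinForm ℝ (EuclideanSpace ℝ (Fin n)))
      (dx n ∘ₗ LinearMap.fst ℝ _ ℝ) (dx n ∘ₗ LinearMap.fst ℝ _ ℝ) :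
    LinearMap.BilinForm ℝ ((ℝ × EuclideanSpace ℝ (Fin n) × ℝ) × ℝ))

/-- The function `φ̃(s)` on the total space. -/
def totDensity (A : NormalSpace n M) (τ : ℝ) : (ℝ × M × ℝ) × ℝ → ℝ := fun q =>
  (A.slice τ q.2).ambDensity (lamAt τ q.2) (q.1.1, q.1.2.1, uAt τ q.2 q.1.2.2)

/-- The function `τ` on the total space. -/
def totTau (M : Type*) (τ : ℝ) : (ℝ × M × ℝ) × ℝ → ℝ := fun q => tauAt τ q.2

/-- The function `(v_{1,φ})_{u(s)}` on the total space: its value at a point is `v_{1,φ}` of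
the manifold with density `(M, g_{u(s)}(s), φ̃(s)(v, ·, u(s)), λ(s))` through that point. -/
def totV₁ (A : NormalSpace n M) (τ : ℝ) : (ℝ × M × ℝ) × ℝ → ℝ := fun q =>
  v₁ (𝓡 n) (baseBasis n) ((A.slice τ q.2).metric (uAt τ q.2 q.1.2.2))
    ((A.slice τ q.2).leafDensity (lamAt τ q.2) q.1.1 (uAt τ q.2 q.1.2.2)) (lamAt τ q.2) q.1.2.1

/-- The vector field
`Y = (1 - λ(s) u(s))⁻¹ (v_{1,φ})_{u(s)} ∂_v - (1 - λ(s) u(s)) ∂_{u(s)} + ∂_s`,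
with `∂_{u(s)} = (1 - s/τ)⁻¹ ∂_u` in the coordinates `((v, x, u), s)`. -/
def flowField (A : NormalSpace n M) (τ : ℝ) (q : (ℝ × M × ℝ) × ℝ) : TangentSpace (totI n) q :=
  (((1 - lamAt τ q.2 * uAt τ q.2 q.1.2.2)⁻¹ * A.totV₁ τ q,
    (0 : EuclideanSpace ℝ (Fin n)),
    -(1 - lamAt τ q.2 * uAt τ q.2 q.1.2.2) * (1 - q.2 / τ)⁻¹), (1 : ℝ))

end NormalSpace

end WeightedAmbient

end

/-!
With `c = 1 - s / τ`, the metric `g̃(s)` is `c` times the pull-back of `g̃` under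
`(v, x, w) ↦ (v, x, w / c)`, and `φ̃(s)` is the pull-back of `φ̃`. Under such a homothety, with
`λ ↦ λ / c`, the tensor `P` is pulled back and `F` is pulled back and multiplied by `c⁻¹`, so the
slices are again weighted ambient spaces.

In normal form the part of `P̃ = 0` tangent to the leaves reads
`(1 - λ u) ∂_u g_u = 2 (Ric + ∇²φ - λ g_u)`. Adding the trace of this equation to `F̃ = 0` gives
`2 (1 - λ u) ∂_u φ̃ = R + |∇φ|² - 2 λ φ`. The field `Y` has no component along `M` while the total
metric annihilates the other directions, so `L_Y g` is the directional derivative of its components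
along `Y`, and the leaf equations of the slices turn `L_Y g` and `L_Y φ` into the flow equations.
-/

noncomputable section

namespace WeightedAmbient

open Filter Topology

/-! ### Coordinate formulas -/

section Coordinates

variable {ι E : Type*} [NormedAddCommGroup E] [NormedSpace ℝ E]

section PartialDerivative

variable {b : Module.Basis ι ℝ E} {f g : E → ℝ} {y : E}

theorem pd_congr (h : f =ᶠ[𝓝 y] g) (i : ι) : pd b i f y = pd b i g y := by
  simp only [pd, h.fderiv_eq]

theorem pd_const (i : ι) (c : ℝ) (y : E) : pd b i (fun _ => c) y = 0 := by
  rw [pd, fderiv_const_apply, zero_apply]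

theorem pd_eq_zero_of_eventually (h : ∀ᶠ z in 𝓝 y, f z = 0) (i : ι) : pd b i f y = 0 := by
  rw [pd_congr (g := fun _ => 0) h, pd_const]

theorem pd_const_mul (i : ι) (c : ℝ) (f : E → ℝ) (y : E) :
    pd b i (fun z => c * f z) y = c * pd b i f y :=
  congrArg (· (b i)) (congrFun (fderiv_const_smul_field (𝕜 := ℝ) (f := f) c) y)

theorem pd_comp_equiv {L : E ≃L[ℝ] E} {i : ι} {d : ℝ} (hL : L (b i) = d • b i) (f : E → ℝ)
    (y : E) : pd b i (f ∘ L) y = d * pd b i f (L y) := by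
  rw [pd, L.comp_right_fderiv, ContinuousLinearMap.comp_apply, ContinuousLinearEquiv.coe_coe, hL,
    map_smul, smul_eq_mul, pd]

theorem differentiableAt_of_contDiffOn {U : Set E} (hU : IsOpen U) (hf : ContDiffOn ℝ ∞ f U)
    (hy : y ∈ U) : DifferentiableAt ℝ f y :=
  (hf.contDiffAt (hU.mem_nhds hy)).differentiableAt (by simp)

theorem contDiffOn_pd (i : ι) {U : Set E} (hU : IsOpen U) (hf : ContDiffOn ℝ ∞ f U) :
    ContDiffOn ℝ ∞ (pd b i f) U :=
  (hf.fderiv_of_isOpen hU (by simp)).clm_apply contDiffOn_const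

theorem pd_pd_eq_fderiv_fderiv (hf : ContDiffAt ℝ 2 f y) (i j : ι) :
    pd b i (pd b j f) y = fderiv ℝ (fderiv ℝ f) y (b i) (b j) := by
  have hf' : DifferentiableAt ℝ (fderiv ℝ f) y :=
    (hf.fderiv_right (m := 1) (by norm_num)).differentiableAt (by norm_num)
  change fderiv ℝ (fun z => fderiv ℝ f z (b j)) y (b i) = _
  simp [fderiv_clm_apply hf' (differentiableAt_const _)]

theorem pd_comm (hf : ContDiffAt ℝ 2 f y) (i j : ι) :
    pd b i (pd b j f) y = pd b j (pd b i f) y := by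
  rw [pd_pd_eq_fderiv_fderiv hf, pd_pd_eq_fderiv_fderiv hf]
  exact (hf.isSymmSndFDerivAt (by rw [minSmoothness_of_isRCLikeNormedField])).eq _ _

theorem pd_add_smul_of_invariant {i : ι} (hf : ∀ (t : ℝ) (z : E), f (z + t • b i) = f z) (j : ι)
    (t : ℝ) (y : E) : pd b j f (y + t • b i) = pd b j f y := by
  rw [pd, ← fderiv_comp_add_right, funext (hf t), pd]

theorem pd_eq_zero_of_invariant {i : ι} (hf : ∀ (t : ℝ) (z : E), f (z + t • b i) = f z) (y : E) :
    pd b i f y = 0 := by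
  by_cases h : DifferentiableAt ℝ f y
  · rw [pd, ← h.lineDeriv_eq_fderiv, lineDeriv, funext fun t => hf t y, deriv_const]
  · rw [pd, fderiv_zero_of_not_differentiableAt h, zero_apply]

theorem sum_repr_mul_pd [Fintype ι] (b : Module.Basis ι ℝ E) (f : E → ℝ) (y v : E) :
    ∑ k, b.repr v k * pd b k f y = fderiv ℝ f y v := by
  conv_rhs => rw [← b.sum_repr v]
  simp only [pd, map_sum, map_smul, smul_eq_mul]

end PartialDerivative

section Locality

variable [Fintype ι] [DecidableEq ι] {b : Module.Basis ι ℝ E} {G G' : E → Matrix ι ι ℝ} {y : E}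

theorem christoffel_congr (h : G =ᶠ[𝓝 y] G') (k i j : ι) :
    christoffel b G k i j y = christoffel b G' k i j y := by
  have h' (i j) : (fun z => G z i j) =ᶠ[𝓝 y] fun z => G' z i j :=
    h.mono fun z hz => congrFun (congrFun hz i) j
  simp only [christoffel, h.eq_of_nhds, pd_congr (h' _ _)]

theorem ricciCoord_congr (h : G =ᶠ[𝓝 y] G') (i j : ι) :
    ricciCoord b G i j y = ricciCoord b G' i j y := by
  have h' (k i j) : christoffel b G k i j =ᶠ[𝓝 y] christoffel b G' k i j :=
    h.eventuallyEq_nhds.mono fun z hz => christoffel_congr hz k i j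
  simp only [ricciCoord, pd_congr (h' _ _ _), christoffel_congr h]

theorem hessCoord_congr (h : G =ᶠ[𝓝 y] G') (f : E → ℝ) (i j : ι) :
    hessCoord b G f i j y = hessCoord b G' f i j y := by
  simp only [hessCoord, christoffel_congr h]

end Locality

section Smoothness

variable [Fintype ι] [DecidableEq ι] {U : Set E} {G : E → Matrix ι ι ℝ} {m : WithTop ℕ∞}

theorem contDiffOn_det (hG : ∀ i j, ContDiffOn ℝ m (fun y => G y i j) U) :
    ContDiffOn ℝ m (fun y => (G y).det) U := by
  simp only [Matrix.det_apply']
  exact ContDiffOn.sum fun σ _ => contDiffOn_const.mul (contDiffOn_prod fun i _ => hG _ _)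

theorem contDiffOn_inv (hG : ∀ i j, ContDiffOn ℝ m (fun y => G y i j) U)
    (hdet : ∀ y ∈ U, IsUnit (G y).det) (k l : ι) :
    ContDiffOn ℝ m (fun y => (G y)⁻¹ k l) U := by
  simp only [Matrix.inv_def, Matrix.smul_apply, Ring.inverse_eq_inv', smul_eq_mul,
    Matrix.adjugate_apply]
  refine ((contDiffOn_det hG).inv fun y hy => (hdet y hy).ne_zero).mul
    (contDiffOn_det fun i j => ?_)
  obtain rfl | hi := eq_or_ne i l
  · simpa only [Matrix.updateRow_self] using contDiffOn_const
  · simpa only [Matrix.updateRow_ne hi] using hG i j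

theorem contDiffOn_christoffel (b : Module.Basis ι ℝ E) (hU : IsOpen U)
    (hG : ∀ i j, ContDiffOn ℝ ∞ (fun y => G y i j) U) (hdet : ∀ y ∈ U, IsUnit (G y).det)
    (k i j : ι) : ContDiffOn ℝ ∞ (christoffel b G k i j) U :=
  contDiffOn_const.mul (ContDiffOn.sum fun l _ => (contDiffOn_inv hG hdet k l).mul
    (((contDiffOn_pd i hU (hG j l)).add (contDiffOn_pd j hU (hG i l))).sub
      (contDiffOn_pd l hU (hG i j))))

end Smoothness

/-- The field of matrices `G'` is `c` times the pull-back of `G` under the linear map `L`, which is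
diagonal in the basis `b` with eigenvalues `d`. -/
structure IsScaledPullback (b : Module.Basis ι ℝ E) (L : E ≃L[ℝ] E) (d : ι → ℝ) (c : ℝ)
    (G' G : E → Matrix ι ι ℝ) : Prop where
  map_basis : ∀ i, L (b i) = d i • b i
  factor_ne_zero : c ≠ 0
  entry : ∀ y i j, G' y i j = c * (d i * d j) * G (L y) i j

namespace IsScaledPullback

variable {b : Module.Basis ι ℝ E} {L : E ≃L[ℝ] E} {d : ι → ℝ} {c : ℝ} {G G' : E → Matrix ι ι ℝ}

theorem eigenvalue_ne_zero (h : IsScaledPullback b L d c G' G) (i : ι) : d i ≠ 0 := fun hi =>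
  b.ne_zero i (L.injective (by rw [h.map_basis, hi, zero_smul, map_zero]))

theorem pd_entry_eq (h : IsScaledPullback b L d c G' G) (k i j : ι) (y : E) :
    pd b k (fun z => G' z i j) y = c * (d i * d j) * (d k * pd b k (fun z => G z i j) (L y)) := by
  simp only [h.entry, pd_const_mul]
  rw [← pd_comp_equiv (h.map_basis k)]
  rfl

variable [Fintype ι] [DecidableEq ι]

theorem inv_entry_eq (h : IsScaledPullback b L d c G' G) (y : E) (k l : ι) :
    (G' y)⁻¹ k l = c⁻¹ * ((d k)⁻¹ * (d l)⁻¹) * (G (L y))⁻¹ k l := by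
  have hinv {e : ι → ℝ} (he : ∀ i, e i ≠ 0) :
      (Matrix.diagonal e)⁻¹ = Matrix.diagonal fun i => (e i)⁻¹ :=
    Matrix.inv_eq_right_inv (by simp [Matrix.diagonal_mul_diagonal, he])
  have hG : G' y = Matrix.diagonal (fun i => c * d i) * G (L y) * Matrix.diagonal d := by
    ext i j
    rw [Matrix.mul_diagonal, Matrix.diagonal_mul, h.entry]
    ring
  rw [hG, Matrix.mul_inv_rev, Matrix.mul_inv_rev, hinv h.eigenvalue_ne_zero,
    hinv fun i => mul_ne_zero h.factor_ne_zero (h.eigenvalue_ne_zero i), Matrix.diagonal_mul,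
    Matrix.mul_diagonal, mul_inv]
  ring

theorem christoffel_eq (h : IsScaledPullback b L d c G' G) (k i j : ι) (y : E) :
    christoffel b G' k i j y = (d i * d j * (d k)⁻¹) * christoffel b G k i j (L y) := by
  simp only [christoffel, h.pd_entry_eq, h.inv_entry_eq, Finset.mul_sum]
  refine Finset.sum_congr rfl fun l _ => ?_
  have := h.factor_ne_zero
  have := h.eigenvalue_ne_zero l
  have := h.eigenvalue_ne_zero k
  field_simp

theorem pd_christoffel_eq (h : IsScaledPullback b L d c G' G) (m k i j : ι) (y : E) :
    pd b m (christoffel b G' k i j) y =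
      (d i * d j * (d k)⁻¹) * (d m * pd b m (christoffel b G k i j) (L y)) := by
  rw [funext (h.christoffel_eq k i j), pd_const_mul, ← pd_comp_equiv (h.map_basis m)]
  rfl

theorem ricciCoord_eq (h : IsScaledPullback b L d c G' G) (i j : ι) (y : E) :
    ricciCoord b G' i j y = d i * d j * ricciCoord b G i j (L y) := by
  simp only [ricciCoord, h.pd_christoffel_eq, h.christoffel_eq, mul_add, mul_sub,
    Finset.mul_sum]
  have hd := h.eigenvalue_ne_zero
  congr 2
  · exact Finset.sum_congr rfl fun k _ => by field_simp [hd k]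
  · exact Finset.sum_congr rfl fun k _ => by field_simp [hd k]
  · exact funext fun k => Finset.sum_congr rfl fun l _ => by field_simp [hd k, hd l]

theorem hessCoord_eq (h : IsScaledPullback b L d c G' G) (f : E → ℝ) (i j : ι) (y : E) :
    hessCoord b G' (f ∘ L) i j y = d i * d j * hessCoord b G f i j (L y) := by
  have hpd (k) : pd b k (f ∘ L) = fun z => d k * (pd b k f ∘ L) z :=
    funext (pd_comp_equiv (h.map_basis k) f)
  have hpd₂ : pd b i (pd b j (f ∘ L)) y = d i * d j * pd b i (pd b j f) (L y) := by
    rw [hpd j, pd_const_mul, pd_comp_equiv (h.map_basis i)]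
    ring
  simp only [hessCoord, hpd₂, pd_comp_equiv (h.map_basis _), h.christoffel_eq,
    mul_sub, Finset.mul_sum]
  have hd := h.eigenvalue_ne_zero
  congr 1
  exact Finset.sum_congr rfl fun k _ => by field_simp [hd k]

end IsScaledPullback

end Coordinates

section MetricTrace

variable {ι : Type*} [Fintype ι] [DecidableEq ι]

/-- The trace `gⁱʲ Tᵢⱼ` of a bilinear form `T` with respect to the metric `g`. -/
def metricTrace (g T : Matrix ι ι ℝ) : ℝ := ∑ i, ∑ j, g⁻¹ i j * T i j

theorem metricTrace_eq_trace (g T : Matrix ι ι ℝ) : metricTrace g T = (g⁻¹ * T.transpose).trace :=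
  rfl

theorem metricTrace_add (g S T : Matrix ι ι ℝ) :
    metricTrace g (S + T) = metricTrace g S + metricTrace g T := by
  simp only [metricTrace_eq_trace, Matrix.transpose_add, mul_add, Matrix.trace_add]

theorem metricTrace_smul (g T : Matrix ι ι ℝ) (a : ℝ) :
    metricTrace g (a • T) = a * metricTrace g T := by
  simp only [metricTrace_eq_trace, Matrix.transpose_smul, Matrix.mul_smul, Matrix.trace_smul,
    smul_eq_mul]

theorem metricTrace_self {g : Matrix ι ι ℝ} (hg : IsUnit g.det) (hs : g.IsSymm) :
    metricTrace g g = Fintype.card ι := by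
  rw [metricTrace_eq_trace, hs.eq, Matrix.nonsing_inv_mul g hg, Matrix.trace_one]

end MetricTrace

/-! ### Tensors in charts -/

section Charts

variable {ι E H N : Type*} [NormedAddCommGroup E] [NormedSpace ℝ E] [TopologicalSpace H]
  [TopologicalSpace N] [ChartedSpace H N] {I : ModelWithCorners ℝ E H} {b : Module.Basis ι ℝ E}

theorem coordTensor_apply {h : TwoTensor I N} {p q : N} {y : E}
    (hq : (extChartAt I p).symm y = q) {D : E →L[ℝ] E}
    (hD : fderiv ℝ (fun z => extChartAt I q ((extChartAt I p).symm z)) y = D) (i j : ι) :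
    coordTensor I b h p y i j = h q (D (b i) : E) (D (b j) : E) := by
  subst hq hD
  rfl

theorem coordField_apply {Y : (q : N) → TangentSpace I q} {p q : N} {y : E}
    (hq : (extChartAt I p).symm y = q) {D : E →L[ℝ] E}
    (hD : fderiv ℝ (fun z => extChartAt I p ((extChartAt I q).symm z)) (extChartAt I q q) = D)
    (k : ι) : coordField I b Y p k y = b.repr (D (Y q : E)) k := by
  subst hq hD
  rfl

theorem hasFDerivAt_coordChange [I.Boundaryless] [IsManifold I 1 N] {p q : N} {y : E}
    (hy : y ∈ (extChartAt I p).target)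
    (hq : (extChartAt I p).symm y ∈ (extChartAt I q).source) :
    HasFDerivAt (fun z => extChartAt I q ((extChartAt I p).symm z))
      (tangentCoordChange I p q ((extChartAt I p).symm y)) y := by
  have := hasFDerivWithinAt_tangentCoordChange (I := I) (x := p) (y := q)
    (z := (extChartAt I p).symm y) ⟨(extChartAt I p).map_target hy, hq⟩
  rwa [I.range_eq_univ, hasFDerivWithinAt_univ, (extChartAt I p).right_inv hy] at this

theorem fderiv_chart_self [I.Boundaryless] (p : N) :
    fderiv ℝ (fun z => extChartAt I p ((extChartAt I p).symm z)) (extChartAt I p p) =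
      ContinuousLinearMap.id ℝ E := by
  refine ((hasFDerivAt_id _).congr_of_eventuallyEq ?_).fderiv
  filter_upwards [extChartAt_target_mem_nhds p] with z hz using (extChartAt I p).right_inv hz

theorem coordTensor_self [I.Boundaryless] (h : TwoTensor I N) (p : N) (i j : ι) :
    coordTensor I b h p (extChartAt I p p) i j = h p (b i : E) (b j : E) :=
  coordTensor_apply (extChartAt_to_inv p) (fderiv_chart_self p) i j

theorem coordField_self [I.Boundaryless] (Y : (q : N) → TangentSpace I q) (p : N) (k : ι) :
    coordField I b Y p k (extChartAt I p p) = b.repr (Y p : E) k :=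
  coordField_apply (extChartAt_to_inv p) (fderiv_chart_self p) k

theorem evalComponents_basis [Fintype ι] (p : N) (c : ι → ι → ℝ) (i j : ι) :
    evalComponents I b p c (b i : E) (b j : E) = c i j := by
  classical
  simp [evalComponents, Finsupp.single_apply]

theorem mul_evalComponents [Fintype ι] (p : N) (r : ℝ) (c : ι → ι → ℝ) (X Y : TangentSpace I p) :
    r * evalComponents I b p c X Y = evalComponents I b p (r • c) X Y := by
  simp only [evalComponents, Finset.mul_sum, Pi.smul_apply, smul_eq_mul, mul_assoc]

theorem isUnit_det_coordTensor [Fintype ι] [DecidableEq ι] [I.Boundaryless] [IsManifold I 1 N]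
    {h : TwoTensor I N} {p : N} {y : E} (hy : y ∈ (extChartAt I p).target)
    (hpos : ∀ X : TangentSpace I ((extChartAt I p).symm y), X ≠ 0 → 0 < h _ X X) :
    IsUnit (coordTensor I b h p y).det := by
  set q := (extChartAt I p).symm y with hq
  have hqp : q ∈ (extChartAt I p).source := (extChartAt I p).map_target hy
  have hqq : q ∈ (extChartAt I q).source := mem_extChartAt_source q
  set T := tangentCoordChange I p q q
  have hT : Function.LeftInverse (tangentCoordChange I q p q) T := fun X => by
    rw [tangentCoordChange_comp ⟨⟨hqp, hqq⟩, hqp⟩, tangentCoordChange_self hqp]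
  let B₀ : LinearMap.BilinForm ℝ E := h q
  let B : LinearMap.BilinForm ℝ E := B₀.compl₁₂ (T : E →ₗ[ℝ] E) (T : E →ₗ[ℝ] E)
  have hB (X : E) (hX : B X X = 0) : X = 0 := by
    by_contra hne
    have hTX : 0 < B X X :=
      hpos (T X) fun h0 => hne (hT.injective (h0.trans (map_zero T).symm))
    exact hTX.ne' hX
  have hmat : coordTensor I b h p y = LinearMap.BilinForm.toMatrix b B := by
    ext i j
    rw [LinearMap.BilinForm.toMatrix_apply]
    exact coordTensor_apply hq.symm (hasFDerivAt_coordChange hy hqq).fderiv i j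
  rw [hmat, isUnit_iff_ne_zero, ← LinearMap.BilinForm.nondegenerate_iff_det_ne_zero]
  exact ⟨fun X hX => hB X (hX X), fun X hX => hB X (hX X)⟩

theorem lieTensor_eq_evalComponents_fderiv [Fintype ι] [I.Boundaryless]
    {Y : (q : N) → TangentSpace I q} {h : TwoTensor I N} {p : N}
    (hY : ∀ k, (∀ i, coordTensor I b h p (extChartAt I p p) k i = 0 ∧
        coordTensor I b h p (extChartAt I p p) i k = 0) ∨
      ∀ᶠ y in 𝓝 (extChartAt I p p), coordField I b Y p k y = 0) (X Z : TangentSpace I p) :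
    lieTensor I b Y h p X Z = evalComponents I b p (fun i j =>
      fderiv ℝ (fun y => coordTensor I b h p y i j) (extChartAt I p p) (Y p)) X Z := by
  have hzero (k i j : ι) : coordTensor I b h p (extChartAt I p p) k j *
        pd b i (coordField I b Y p k) (extChartAt I p p) = 0 ∧
      coordTensor I b h p (extChartAt I p p) i k *
        pd b j (coordField I b Y p k) (extChartAt I p p) = 0 := by
    rcases hY k with h0 | h0
    · rw [(h0 j).1, (h0 i).2, zero_mul, zero_mul]
      exact ⟨rfl, rfl⟩
    · rw [pd_eq_zero_of_eventually h0, pd_eq_zero_of_eventually h0, mul_zero, mul_zero]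
      exact ⟨rfl, rfl⟩
  simp only [lieTensor, (hzero _ _ _).1, (hzero _ _ _).2, add_zero, coordField_self]
  exact congrArg (evalComponents I b p · X Z)
    (funext fun i => funext fun j => sum_repr_mul_pd b _ _ _)

variable [Fintype ι] [DecidableEq ι]

theorem scalar_eq_metricTrace (h : TwoTensor I N) (p : N) :
    scalar I b h p = metricTrace (coordTensor I b h p (extChartAt I p p))
      (Matrix.of fun i j => ricciCoord b (coordTensor I b h p) i j (extChartAt I p p)) := rfl

theorem laplacian_eq_metricTrace (h : TwoTensor I N) (f : N → ℝ) (p : N) :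
    laplacian I b h f p = metricTrace (coordTensor I b h p (extChartAt I p p))
      (Matrix.of fun i j =>
        hessCoord b (coordTensor I b h p) (coordFun I f p) i j (extChartAt I p p)) := rfl

theorem gradSq_eq_metricTrace (h : TwoTensor I N) (f : N → ℝ) (p : N) :
    gradSq I b h f p = metricTrace (coordTensor I b h p (extChartAt I p p))
      (Matrix.of fun i j => pd b i (coordFun I f p) (extChartAt I p p) *
        pd b j (coordFun I f p) (extChartAt I p p)) := by
  simp only [gradSq, metricTrace, Matrix.of_apply, mul_assoc]

theorem weightedRicci_eq_evalComponents (h : TwoTensor I N) (φ : N → ℝ) (p : N)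
    (X Y : TangentSpace I p) :
    weightedRicci I b h φ p X Y = evalComponents I b p (fun i j =>
      ricciCoord b (coordTensor I b h p) i j (extChartAt I p p) +
      hessCoord b (coordTensor I b h p) (coordFun I φ p) i j (extChartAt I p p)) X Y := by
  simp only [weightedRicci, ricci, hess, evalComponents, add_mul, Finset.sum_add_distrib]

end Charts

section Homothety

variable {ι E H N : Type*} [NormedAddCommGroup E] [NormedSpace ℝ E] [TopologicalSpace H]
  [TopologicalSpace N] [ChartedSpace H N]

/-- The tensor `h'` is `c` times the pull-back of `h` under the map `δ`, which in the preferred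
charts is the linear map `L`, diagonal in the basis `b` with eigenvalues `d`. -/
structure IsHomothety (I : ModelWithCorners ℝ E H) (b : Module.Basis ι ℝ E) (δ : N → N)
    (L : E ≃L[ℝ] E) (d : ι → ℝ) (c : ℝ) (h' h : TwoTensor I N) : Prop where
  chart_apply : ∀ p q, extChartAt I (δ p) (δ q) = L (extChartAt I p q)
  chart_symm_apply : ∀ p y, (extChartAt I (δ p)).symm (L y) = δ ((extChartAt I p).symm y)
  map_basis : ∀ i, L (b i) = d i • b i
  factor_ne_zero : c ≠ 0
  pullback : ∀ (q : N) (X Y : E), h' q X Y = c * h (δ q) (L X) (L Y)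

namespace IsHomothety

variable {I : ModelWithCorners ℝ E H} {b : Module.Basis ι ℝ E} {δ : N → N} {L : E ≃L[ℝ] E}
  {d : ι → ℝ} {c : ℝ} {h' h : TwoTensor I N}

theorem coordFun_comp (H : IsHomothety I b δ L d c h' h) (f : N → ℝ) (p : N) :
    coordFun I (f ∘ δ) p = coordFun I f (δ p) ∘ L :=
  funext fun y => congrArg f (H.chart_symm_apply p y).symm

theorem map_fderiv_coordChange (H : IsHomothety I b δ L d c h' h) (p q : N) (y : E) (i : ι) :
    L (fderiv ℝ (fun z => extChartAt I q ((extChartAt I p).symm z)) y (b i)) =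
      d i • fderiv ℝ (fun z => extChartAt I (δ q) ((extChartAt I (δ p)).symm z)) (L y) (b i) := by
  have hconj : (fun z => extChartAt I (δ q) ((extChartAt I (δ p)).symm z)) ∘ L =
      L ∘ fun z => extChartAt I q ((extChartAt I p).symm z) := funext fun z => by
    rw [Function.comp_apply, H.chart_symm_apply, H.chart_apply, Function.comp_apply]
  have hfderiv := congrArg (fun f : E → E => fderiv ℝ f y (b i)) hconj
  rw [L.comp_right_fderiv, L.comp_fderiv] at hfderiv
  rw [← map_smul, ← H.map_basis]
  exact hfderiv.symm

theorem isScaledPullback (H : IsHomothety I b δ L d c h' h) (p : N) :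
    IsScaledPullback b L d c (coordTensor I b h' p) (coordTensor I b h (δ p)) where
  map_basis := H.map_basis
  factor_ne_zero := H.factor_ne_zero
  entry y i j := by
    rw [coordTensor_apply rfl rfl, H.pullback, H.map_fderiv_coordChange,
      H.map_fderiv_coordChange, coordTensor_apply (H.chart_symm_apply p y) rfl]
    set B : LinearMap.BilinForm ℝ E := h (δ ((extChartAt I p).symm y))
    change c * B _ _ = _ * B _ _
    simp only [map_smul, LinearMap.smul_apply, smul_eq_mul]
    ring

variable [Fintype ι]

theorem evalComponents_scale (H : IsHomothety I b δ L d c h' h) (p : N) (C : ι → ι → ℝ)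
    (X Y : E) :
    evalComponents I b p (fun i j => d i * d j * C i j) X Y =
      evalComponents I b (δ p) C (L X : E) (L Y : E) := by
  have hrepr (X : E) (i : ι) : b.repr (L X) i = d i * b.repr X i := by
    have hL : L X = ∑ j, (b.repr X j * d j) • b j := by
      conv_lhs => rw [← b.sum_repr X]
      simp only [map_sum, map_smul, H.map_basis, smul_smul]
    rw [hL, b.repr_sum_self, mul_comm]
  change ∑ i, ∑ j, _ * b.repr X i * b.repr Y j = ∑ i, ∑ j, _ * b.repr (L X) i * b.repr (L Y) j
  simp only [hrepr]
  exact Finset.sum_congr rfl fun i _ => Finset.sum_congr rfl fun j _ => by ring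

variable [DecidableEq ι]

theorem metricTrace_scale (H : IsHomothety I b δ L d c h' h) (p : N) (T : Matrix ι ι ℝ) :
    metricTrace (coordTensor I b h' p (extChartAt I p p)) (Matrix.of fun i j => d i * d j * T i j) =
      c⁻¹ * metricTrace (coordTensor I b h (δ p) (extChartAt I (δ p) (δ p))) T := by
  have hd := (H.isScaledPullback p).eigenvalue_ne_zero
  simp only [metricTrace, (H.isScaledPullback p).inv_entry_eq, ← H.chart_apply, Finset.mul_sum,
    Matrix.of_apply]
  exact Finset.sum_congr rfl fun i _ => Finset.sum_congr rfl fun j _ => by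
    field_simp [hd i, hd j]

theorem weightedRicci_comp (H : IsHomothety I b δ L d c h' h) (f : N → ℝ) (p : N)
    (X Y : E) :
    weightedRicci I b h' (f ∘ δ) p X Y = weightedRicci I b h f (δ p) (L X : E) (L Y : E) := by
  refine (weightedRicci_eq_evalComponents h' _ p X Y).trans ?_
  refine .trans ?_ (weightedRicci_eq_evalComponents h f (δ p) (L X) (L Y)).symm
  refine .trans ?_ (H.evalComponents_scale p _ X Y)
  simp only [(H.isScaledPullback p).ricciCoord_eq, H.coordFun_comp,
    (H.isScaledPullback p).hessCoord_eq, H.chart_apply, mul_add]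

theorem weightedP_comp (H : IsHomothety I b δ L d c h' h) (f : N → ℝ) (lam : ℝ) (p : N)
    (X Y : E) :
    weightedP I b h' (f ∘ δ) (lam / c) p X Y = weightedP I b h f lam (δ p) (L X : E) (L Y : E) := by
  change weightedRicci I b h' (f ∘ δ) p X Y - lam / c * h' p X Y = _
  have hpullback : lam / c * h' p X Y = lam * h (δ p) (L X : E) (L Y : E) := by
    rw [H.pullback, ← mul_assoc, div_mul_cancel₀ _ H.factor_ne_zero]
  exact congrArg₂ (· - ·) (H.weightedRicci_comp f p X Y) hpullback

theorem laplacian_comp (H : IsHomothety I b δ L d c h' h) (f : N → ℝ) (p : N) :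
    laplacian I b h' (f ∘ δ) p = c⁻¹ * laplacian I b h f (δ p) := by
  simp only [laplacian_eq_metricTrace, H.coordFun_comp, (H.isScaledPullback p).hessCoord_eq,
    ← H.chart_apply, ← H.metricTrace_scale, Matrix.of_apply]

theorem gradSq_comp (H : IsHomothety I b δ L d c h' h) (f : N → ℝ) (p : N) :
    gradSq I b h' (f ∘ δ) p = c⁻¹ * gradSq I b h f (δ p) := by
  simp only [gradSq_eq_metricTrace, H.coordFun_comp, pd_comp_equiv (H.map_basis _),
    ← H.chart_apply, ← H.metricTrace_scale, Matrix.of_apply, mul_mul_mul_comm]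

theorem weightedF_comp (H : IsHomothety I b δ L d c h' h) (f : N → ℝ) (lam : ℝ) (p : N) :
    weightedF I b h' (f ∘ δ) (lam / c) p = c⁻¹ * weightedF I b h f lam (δ p) := by
  rw [weightedF, weightedF, H.laplacian_comp, H.gradSq_comp, Function.comp_apply]
  ring

end IsHomothety

end Homothety

/-! ### Metrics in normal form -/

section NormalForm

variable {n : ℕ}

/-- The model vector space of `ℝ × M × ℝ`. -/
abbrev AmbModel (n : ℕ) : Type := ℝ × EuclideanSpace ℝ (Fin n) × ℝ

/-- The index set of the coordinates `v, xⁱ, u`. -/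
abbrev AmbIndex (n : ℕ) : Type := Unit ⊕ (Fin n ⊕ Unit)

/-- The index of the coordinate `v`. -/
abbrev idxV : AmbIndex n := .inl ()

/-- The index of the coordinate `xⁱ`. -/
abbrev idxX (i : Fin n) : AmbIndex n := .inr (.inl i)

/-- The index of the coordinate `u`. -/
abbrev idxU : AmbIndex n := .inr (.inr ())

/-- The matrix of `2 du dv + g` in the basis `∂_v, ∂_i, ∂_u`. -/
def normalMatrix (g : Matrix (Fin n) (Fin n) ℝ) : Matrix (AmbIndex n) (AmbIndex n) ℝ
  | .inl _, .inr (.inr _) => 1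
  | .inr (.inr _), .inl _ => 1
  | .inr (.inl i), .inr (.inl j) => g i j
  | _, _ => 0

section Entries

variable (g : Matrix (Fin n) (Fin n) ℝ) (i j : Fin n)

@[simp] theorem normalMatrix_vv : normalMatrix g idxV idxV = 0 := rfl
@[simp] theorem normalMatrix_vx : normalMatrix g idxV (idxX j) = 0 := rfl
@[simp] theorem normalMatrix_vu : normalMatrix g idxV idxU = 1 := rfl
@[simp] theorem normalMatrix_xv : normalMatrix g (idxX i) idxV = 0 := rfl
@[simp] theorem normalMatrix_xx : normalMatrix g (idxX i) (idxX j) = g i j := rfl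
@[simp] theorem normalMatrix_xu : normalMatrix g (idxX i) idxU = 0 := rfl
@[simp] theorem normalMatrix_uv : normalMatrix g idxU idxV = 1 := rfl
@[simp] theorem normalMatrix_ux : normalMatrix g idxU (idxX j) = 0 := rfl
@[simp] theorem normalMatrix_uu : normalMatrix g idxU idxU = 0 := rfl

end Entries

theorem normalMatrix_mul_eq_one {g h : Matrix (Fin n) (Fin n) ℝ} (hgh : g * h = 1) :
    normalMatrix g * normalMatrix h = 1 := by
  ext I J
  rcases I with ⟨⟨⟩⟩ | I | ⟨⟨⟩⟩ <;> rcases J with ⟨⟨⟩⟩ | J | ⟨⟨⟩⟩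
  case inr.inl.inr.inl =>
    simpa [Matrix.mul_apply, Fintype.sum_sum_type, Matrix.one_apply] using
      congrFun (congrFun hgh I) J
  all_goals simp [Matrix.mul_apply, Fintype.sum_sum_type]

theorem normalMatrix_inv {g : Matrix (Fin n) (Fin n) ℝ} (hg : IsUnit g.det) :
    (normalMatrix g)⁻¹ = normalMatrix g⁻¹ :=
  Matrix.inv_eq_right_inv (normalMatrix_mul_eq_one (Matrix.mul_nonsing_inv _ hg))

theorem isUnit_det_normalMatrix {g : Matrix (Fin n) (Fin n) ℝ} (hg : IsUnit g.det) :
    IsUnit (normalMatrix g).det :=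
  Matrix.isUnit_det_of_right_inverse (normalMatrix_mul_eq_one (Matrix.mul_nonsing_inv _ hg))

theorem metricTrace_normalMatrix {g : Matrix (Fin n) (Fin n) ℝ} (hg : IsUnit g.det)
    (T : Matrix (AmbIndex n) (AmbIndex n) ℝ) :
    metricTrace (normalMatrix g) T =
      metricTrace g (T.submatrix idxX idxX) + T idxU idxV + T idxV idxU := by
  simp only [metricTrace, normalMatrix_inv hg, Fintype.sum_sum_type, Finset.univ_unique,
    Finset.sum_singleton, PUnit.default_eq_unit, normalMatrix_vv, normalMatrix_vx, normalMatrix_vu,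
    normalMatrix_xv, normalMatrix_xx, normalMatrix_xu, normalMatrix_uv, normalMatrix_ux,
    normalMatrix_uu, zero_mul, one_mul, Finset.sum_const_zero, add_zero, zero_add,
    Matrix.submatrix_apply]
  ring

@[simp] theorem ambBasis_v : ambBasis n idxV = (1, 0, 0) := by
  simp [ambBasis, ← Prod.mk_zero_zero]

@[simp] theorem ambBasis_x (i : Fin n) : ambBasis n (idxX i) = (0, baseBasis n i, 0) := by
  simp [ambBasis]

@[simp] theorem ambBasis_u : ambBasis n idxU = (0, 0, 1) := by
  simp [ambBasis]

section Restriction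

variable {F : AmbModel n → ℝ} {y : AmbModel n}

theorem pd_v_eq_deriv (hF : DifferentiableAt ℝ F y) :
    pd (ambBasis n) idxV F y = deriv (fun v => F (v, y.2.1, y.2.2)) y.1 := by
  have hline : HasDerivAt (fun v : ℝ => ((v, y.2.1, y.2.2) : AmbModel n)) (1, 0, 0) y.1 :=
    (hasDerivAt_id _).prodMk (hasDerivAt_const _ _)
  rw [pd, ambBasis_v]
  exact (HasFDerivAt.comp_hasDerivAt (l := F) y.1 hF.hasFDerivAt hline).deriv.symm

theorem pd_u_eq_deriv (hF : DifferentiableAt ℝ F y) :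
    pd (ambBasis n) idxU F y = deriv (fun u => F (y.1, y.2.1, u)) y.2.2 := by
  have hline : HasDerivAt (fun u : ℝ => ((y.1, y.2.1, u) : AmbModel n)) (0, 0, 1) y.2.2 :=
    (hasDerivAt_const _ _).prodMk ((hasDerivAt_const _ _).prodMk (hasDerivAt_id _))
  rw [pd, ambBasis_u]
  exact (HasFDerivAt.comp_hasDerivAt (l := F) y.2.2 hF.hasFDerivAt hline).deriv.symm

theorem pd_x_eq_pd (hF : DifferentiableAt ℝ F y) (i : Fin n) :
    pd (ambBasis n) (idxX i) F y = pd (baseBasis n) i (fun x => F (y.1, x, y.2.2)) y.2.1 := by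
  have hleaf : HasFDerivAt (fun x => ((y.1, x, y.2.2) : AmbModel n))
      ((0 : EuclideanSpace ℝ (Fin n) →L[ℝ] ℝ).prod ((ContinuousLinearMap.id ℝ _).prod 0)) y.2.1 :=
    (hasFDerivAt_const _ _).prodMk ((hasFDerivAt_id _).prodMk (hasFDerivAt_const _ _))
  have hcomp := HasFDerivAt.comp (g := F) y.2.1 hF.hasFDerivAt hleaf
  rw [pd, ambBasis_x, pd, show (fun x => F (y.1, x, y.2.2)) = F ∘ _ from rfl, hcomp.fderiv]
  rfl

theorem pd_v_eq_zero (hF : ∀ v w x u, F (v, x, u) = F (w, x, u)) (y : AmbModel n) :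
    pd (ambBasis n) idxV F y = 0 :=
  pd_eq_zero_of_invariant (fun t z => by
    obtain ⟨v, x, u⟩ := z
    simpa using hF (v + t) v x u) y

theorem eventually_leaf_mem {U : Set (AmbModel n)} (hU : IsOpen U) (hy : y ∈ U) :
    ∀ᶠ x in 𝓝 y.2.1, (y.1, x, y.2.2) ∈ U :=
  (show Continuous fun x : EuclideanSpace ℝ (Fin n) => (y.1, x, y.2.2) by fun_prop).continuousAt
    |>.eventually_mem (hU.mem_nhds hy)

end Restriction

/-- The component matrix of `2 du dv + g_u` as a function of `(v, x, u)`. -/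
def normalField (g : ℝ → EuclideanSpace ℝ (Fin n) → Matrix (Fin n) (Fin n) ℝ) (y : AmbModel n) :
    Matrix (AmbIndex n) (AmbIndex n) ℝ :=
  normalMatrix (g y.2.2 y.2.1)

variable {g : ℝ → EuclideanSpace ℝ (Fin n) → Matrix (Fin n) (Fin n) ℝ} {y : AmbModel n}

section Christoffel

theorem pd_v_metric_eq_zero (i j : Fin n) :
    pd (ambBasis n) idxV (fun z => g z.2.2 z.2.1 i j) y = 0 :=
  pd_v_eq_zero (fun _ _ _ _ => rfl) y

theorem christoffel_normalField_upper_u (hdet : IsUnit (g y.2.2 y.2.1).det) (I J : AmbIndex n) :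
    christoffel (ambBasis n) (normalField g) idxU I J y = 0 := by
  rcases I with ⟨⟨⟩⟩ | I | ⟨⟨⟩⟩ <;> rcases J with ⟨⟨⟩⟩ | J | ⟨⟨⟩⟩ <;>
    simp [christoffel, normalField, normalMatrix_inv hdet, Fintype.sum_sum_type, pd_const,
      pd_v_metric_eq_zero]

theorem christoffel_normalField_lower_v_right (hdet : IsUnit (g y.2.2 y.2.1).det)
    (K I : AmbIndex n) : christoffel (ambBasis n) (normalField g) K I idxV y = 0 := by
  rcases K with ⟨⟨⟩⟩ | K | ⟨⟨⟩⟩ <;> rcases I with ⟨⟨⟩⟩ | I | ⟨⟨⟩⟩ <;>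
    simp [christoffel, normalField, normalMatrix_inv hdet, Fintype.sum_sum_type, pd_const,
      pd_v_metric_eq_zero]

theorem christoffel_normalField_lower_v_left (hdet : IsUnit (g y.2.2 y.2.1).det)
    (K J : AmbIndex n) : christoffel (ambBasis n) (normalField g) K idxV J y = 0 := by
  rcases K with ⟨⟨⟩⟩ | K | ⟨⟨⟩⟩ <;> rcases J with ⟨⟨⟩⟩ | J | ⟨⟨⟩⟩ <;>
    simp [christoffel, normalField, normalMatrix_inv hdet, Fintype.sum_sum_type, pd_const,
      pd_v_metric_eq_zero]

theorem christoffel_normalField_vxx (hdet : IsUnit (g y.2.2 y.2.1).det) (i j : Fin n) :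
    christoffel (ambBasis n) (normalField g) idxV (idxX i) (idxX j) y =
      -(1 / 2) * pd (ambBasis n) idxU (fun z => g z.2.2 z.2.1 i j) y := by
  simp [christoffel, normalField, normalMatrix_inv hdet, Fintype.sum_sum_type, pd_const]

theorem christoffel_normalField_xxx (hdet : IsUnit (g y.2.2 y.2.1).det)
    (hg : ∀ i j, DifferentiableAt ℝ (fun z : AmbModel n => g z.2.2 z.2.1 i j) y) (k i j : Fin n) :
    christoffel (ambBasis n) (normalField g) (idxX k) (idxX i) (idxX j) y =
      christoffel (baseBasis n) (g y.2.2) k i j y.2.1 := by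
  simp [christoffel, normalField, normalMatrix_inv hdet, Fintype.sum_sum_type, pd_x_eq_pd (hg _ _)]

theorem pd_v_christoffel_normalField (K I J : AmbIndex n) :
    pd (ambBasis n) idxV (christoffel (ambBasis n) (normalField g) K I J) y = 0 := by
  have hfield (t : ℝ) (z : AmbModel n) :
      normalField g (z + t • ambBasis n idxV) = normalField g z := by
    rw [ambBasis_v]
    simp [normalField]
  refine pd_eq_zero_of_invariant (fun t z => ?_) y
  have hpd (m I J) := pd_add_smul_of_invariant (b := ambBasis n) (i := idxV)
    (f := fun z => normalField g z I J) (fun t z => by rw [hfield]) m t z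
  simp only [christoffel, hpd, hfield]

end Christoffel

section Curvature

/-- `g_u` is smooth and nondegenerate on the open set `U`, so `2 du dv + g_u` is a smooth
semi-Riemannian metric there. -/
structure IsRegularOn (g : ℝ → EuclideanSpace ℝ (Fin n) → Matrix (Fin n) (Fin n) ℝ)
    (U : Set (AmbModel n)) : Prop where
  isOpen : IsOpen U
  contDiffOn : ∀ i j, ContDiffOn ℝ ∞ (fun z : AmbModel n => g z.2.2 z.2.1 i j) U
  isUnit_det : ∀ z ∈ U, IsUnit (g z.2.2 z.2.1).det

namespace IsRegularOn

variable {U : Set (AmbModel n)} {f : AmbModel n → ℝ}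

theorem differentiableAt (h : IsRegularOn g U) (hy : y ∈ U) (i j : Fin n) :
    DifferentiableAt ℝ (fun z : AmbModel n => g z.2.2 z.2.1 i j) y :=
  differentiableAt_of_contDiffOn h.isOpen (h.contDiffOn i j) hy

theorem contDiffOn_normalField (h : IsRegularOn g U) (I J : AmbIndex n) :
    ContDiffOn ℝ ∞ (fun z => normalField g z I J) U := by
  rcases I with ⟨⟨⟩⟩ | I | ⟨⟨⟩⟩ <;> rcases J with ⟨⟨⟩⟩ | J | ⟨⟨⟩⟩ <;>
    simp [normalField, contDiffOn_const, h.contDiffOn]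

theorem pd_christoffel_xxx (h : IsRegularOn g U) (hy : y ∈ U) (m k i j : Fin n) :
    pd (ambBasis n) (idxX m)
        (christoffel (ambBasis n) (normalField g) (idxX k) (idxX i) (idxX j)) y =
      pd (baseBasis n) m (christoffel (baseBasis n) (g y.2.2) k i j) y.2.1 := by
  have hdet (z) (hz : z ∈ U) : IsUnit (normalField g z).det :=
    isUnit_det_normalMatrix (h.isUnit_det z hz)
  rw [pd_x_eq_pd (differentiableAt_of_contDiffOn h.isOpen (contDiffOn_christoffel _ h.isOpen
    h.contDiffOn_normalField hdet _ _ _) hy)]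
  refine pd_congr ?_ _
  filter_upwards [eventually_leaf_mem h.isOpen hy] with x hx
  exact christoffel_normalField_xxx (h.isUnit_det _ hx) (h.differentiableAt hx) k i j

theorem ricciCoord_xx (h : IsRegularOn g U) (hy : y ∈ U) (i j : Fin n) :
    ricciCoord (ambBasis n) (normalField g) (idxX i) (idxX j) y =
      ricciCoord (baseBasis n) (g y.2.2) i j y.2.1 := by
  have hdet := h.isUnit_det y hy
  have hpd_upper_u (m I J) :
      pd (ambBasis n) m (christoffel (ambBasis n) (normalField g) idxU I J) y = 0 := by
    refine pd_eq_zero_of_eventually ?_ _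
    filter_upwards [h.isOpen.mem_nhds hy] with z hz
    exact christoffel_normalField_upper_u (h.isUnit_det z hz) I J
  have hpd_lower_v (m K I) :
      pd (ambBasis n) m (christoffel (ambBasis n) (normalField g) K I idxV) y = 0 := by
    refine pd_eq_zero_of_eventually ?_ _
    filter_upwards [h.isOpen.mem_nhds hy] with z hz
    exact christoffel_normalField_lower_v_right (h.isUnit_det z hz) K I
  simp [ricciCoord, Fintype.sum_sum_type, h.pd_christoffel_xxx hy, pd_v_christoffel_normalField,
    hpd_upper_u, hpd_lower_v, christoffel_normalField_upper_u hdet,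
    christoffel_normalField_lower_v_right hdet, christoffel_normalField_lower_v_left hdet,
    christoffel_normalField_xxx hdet (h.differentiableAt hy)]

theorem hessCoord_xx (h : IsRegularOn g U) (hf : ContDiffOn ℝ ∞ f U) (hy : y ∈ U) (i j : Fin n) :
    hessCoord (ambBasis n) (normalField g) f (idxX i) (idxX j) y =
      hessCoord (baseBasis n) (g y.2.2) (fun x => f (y.1, x, y.2.2)) i j y.2.1 +
        1 / 2 * pd (ambBasis n) idxV f y *
          pd (ambBasis n) idxU (fun z => g z.2.2 z.2.1 i j) y := by
  have hdet := h.isUnit_det y hy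
  have hpd₂ : pd (ambBasis n) (idxX i) (pd (ambBasis n) (idxX j) f) y =
      pd (baseBasis n) i (pd (baseBasis n) j fun x => f (y.1, x, y.2.2)) y.2.1 := by
    rw [pd_x_eq_pd (differentiableAt_of_contDiffOn h.isOpen (contDiffOn_pd _ h.isOpen hf) hy)]
    refine pd_congr ?_ _
    filter_upwards [eventually_leaf_mem h.isOpen hy] with x hx
    exact pd_x_eq_pd (differentiableAt_of_contDiffOn h.isOpen hf hx) j
  simp only [hessCoord, hpd₂, Fintype.sum_sum_type, Finset.univ_unique, PUnit.default_eq_unit,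
    Finset.sum_singleton, Finset.sum_neg_distrib, Finset.sum_const_zero, one_div, neg_mul, zero_mul,
    add_zero, christoffel_normalField_upper_u hdet, christoffel_normalField_vxx hdet,
    christoffel_normalField_xxx hdet (h.differentiableAt hy),
    pd_x_eq_pd (differentiableAt_of_contDiffOn h.isOpen hf hy)]
  ring

theorem hessCoord_uv (h : IsRegularOn g U) (hy : y ∈ U) :
    hessCoord (ambBasis n) (normalField g) f idxU idxV y =
      pd (ambBasis n) idxU (pd (ambBasis n) idxV f) y := by
  simp only [hessCoord, christoffel_normalField_lower_v_right (h.isUnit_det y hy), zero_mul,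
    Finset.sum_const_zero, sub_zero]

theorem hessCoord_vu (h : IsRegularOn g U) (hf : ContDiffOn ℝ ∞ f U) (hy : y ∈ U) :
    hessCoord (ambBasis n) (normalField g) f idxV idxU y =
      pd (ambBasis n) idxU (pd (ambBasis n) idxV f) y := by
  rw [pd_comm ((hf.contDiffAt (h.isOpen.mem_nhds hy)).of_le (by norm_cast))]
  simp only [hessCoord, christoffel_normalField_lower_v_left (h.isUnit_det y hy), zero_mul,
    Finset.sum_const_zero, sub_zero]

end IsRegularOn

end Curvature

end NormalForm

/-! ### The ambient equations on the leaves -/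

namespace NormalSpace

variable {n : ℕ} {M : Type*} [TopologicalSpace M] [ChartedSpace (EuclideanSpace ℝ (Fin n)) M]

section AmbientCharts

theorem extChartAt_amb (p q : ℝ × M × ℝ) :
    extChartAt (ambI n) p q = (q.1, extChartAt (𝓡 n) p.2.1 q.2.1, q.2.2) := rfl

theorem extChartAt_amb_symm (p : ℝ × M × ℝ) (y : AmbModel n) :
    (extChartAt (ambI n) p).symm y = (y.1, (extChartAt (𝓡 n) p.2.1).symm y.2.1, y.2.2) := rfl

theorem mem_extChartAt_amb_target {p : ℝ × M × ℝ} {y : AmbModel n} :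
    y ∈ (extChartAt (ambI n) p).target ↔ y.2.1 ∈ (extChartAt (𝓡 n) p.2.1).target := by
  simp only [extChartAt_prod, extChartAt_model_space_eq_id, PartialEquiv.prod_target,
    PartialEquiv.refl_target, Set.mem_prod, Set.mem_univ, true_and, and_true]

theorem hasFDerivAt_amb_coordChange {p q : ℝ × M × ℝ} {y : AmbModel n}
    {D : EuclideanSpace ℝ (Fin n) →L[ℝ] EuclideanSpace ℝ (Fin n)}
    (hD : HasFDerivAt (fun z => extChartAt (𝓡 n) q.2.1 ((extChartAt (𝓡 n) p.2.1).symm z)) D y.2.1) :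
    HasFDerivAt (fun z => extChartAt (ambI n) q ((extChartAt (ambI n) p).symm z))
      ((ContinuousLinearMap.id ℝ ℝ).prodMap (D.prodMap (ContinuousLinearMap.id ℝ ℝ))) y :=
  HasFDerivAt.prodMap (f := id) y (hasFDerivAt_id _)
    (HasFDerivAt.prodMap (f₂ := id) y.2 hD (hasFDerivAt_id _))

end AmbientCharts

section Definitions

variable (A : NormalSpace n M)

/-- The metric `g_u` at `x`, as a form on the model space. -/
def leafForm (u : ℝ) (x : M) : LinearMap.BilinForm ℝ (EuclideanSpace ℝ (Fin n)) :=
  A.metric u x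

/-- The matrices of the metrics `g_u` in the chart at `x`. -/
def leafMatrix (x : M) (u : ℝ) (ξ : EuclideanSpace ℝ (Fin n)) : Matrix (Fin n) (Fin n) ℝ :=
  coordTensor (𝓡 n) (baseBasis n) (A.metric u) x ξ

/-- The part of the carrier over the domain of the chart at `x`, in coordinates. -/
def coordDomain (x : M) : Set (AmbModel n) :=
  {y | y.2.1 ∈ (extChartAt (𝓡 n) x).target ∧
    (y.1, (extChartAt (𝓡 n) x).symm y.2.1, y.2.2) ∈ A.carrier}

/-- The matrix of `∂_u g_u` at the point `p`, in the preferred chart there. -/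
def metricDeriv (p : ℝ × M × ℝ) : Matrix (Fin n) (Fin n) ℝ :=
  Matrix.of fun i j =>
    deriv (fun u => A.leafMatrix p.2.1 u (extChartAt (𝓡 n) p.2.1 p.2.1) i j) p.2.2

/-- The derivative `∂_u φ̃` at the point `p`. -/
def densityDeriv (lam : ℝ) (p : ℝ × M × ℝ) : ℝ :=
  deriv (fun u => A.ambDensity lam (p.1, p.2.1, u)) p.2.2

end Definitions

variable {A : NormalSpace n M}

theorem coordDomain_eq (p : ℝ × M × ℝ) :
    A.coordDomain p.2.1 =
      (extChartAt (ambI n) p).target ∩ (extChartAt (ambI n) p).symm ⁻¹' A.carrier := by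
  ext y
  simp only [Set.mem_inter_iff, mem_extChartAt_amb_target, Set.mem_preimage, extChartAt_amb_symm,
    coordDomain, Set.mem_ofPred_eq]

theorem extChartAt_amb_mem_coordDomain {p : ℝ × M × ℝ} (hp : p ∈ A.carrier) :
    extChartAt (ambI n) p p ∈ A.coordDomain p.2.1 := by
  rw [coordDomain_eq p]
  exact ⟨mem_extChartAt_target p, by rwa [Set.mem_preimage, extChartAt_to_inv]⟩

theorem ambMetric_apply (p : ℝ × M × ℝ) (X Y : AmbModel n) :
    A.ambMetric p X Y = X.2.2 * Y.1 + X.1 * Y.2.2 + A.leafForm p.2.2 p.2.1 X.2.1 Y.2.1 := rfl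

section Components

variable [IsManifold (𝓡 n) ∞ M]

theorem coordTensor_ambMetric {p : ℝ × M × ℝ} {y : AmbModel n}
    (hy : y ∈ (extChartAt (ambI n) p).target) :
    coordTensor (ambI n) (ambBasis n) A.ambMetric p y = normalField (A.leafMatrix p.2.1) y := by
  obtain ⟨D, hD⟩ : ∃ D, HasFDerivAt (fun z => extChartAt (𝓡 n)
      ((extChartAt (𝓡 n) p.2.1).symm y.2.1) ((extChartAt (𝓡 n) p.2.1).symm z)) D y.2.1 :=
    ⟨_, hasFDerivAt_coordChange (mem_extChartAt_amb_target.mp hy) (mem_extChartAt_source _)⟩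
  have hleaf (i j : Fin n) : A.leafMatrix p.2.1 y.2.2 y.2.1 i j =
      A.leafForm y.2.2 ((extChartAt (𝓡 n) p.2.1).symm y.2.1)
        (D (baseBasis n i)) (D (baseBasis n j)) :=
    coordTensor_apply rfl hD.fderiv i j
  ext I J
  refine (coordTensor_apply (extChartAt_amb_symm p y) (hasFDerivAt_amb_coordChange (p := p)
    (q := (y.1, (extChartAt (𝓡 n) p.2.1).symm y.2.1, y.2.2)) hD).fderiv I J).trans ?_
  refine (ambMetric_apply _ _ _).trans ?_
  rcases I with ⟨⟨⟩⟩ | I | ⟨⟨⟩⟩ <;> rcases J with ⟨⟨⟩⟩ | J | ⟨⟨⟩⟩ <;>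
    simp [normalField, hleaf]

theorem coordTensor_ambMetric_eventuallyEq (p : ℝ × M × ℝ) :
    coordTensor (ambI n) (ambBasis n) A.ambMetric p =ᶠ[𝓝 (extChartAt (ambI n) p p)]
      normalField (A.leafMatrix p.2.1) := by
  filter_upwards [extChartAt_target_mem_nhds (I := ambI n) p] with y hy
  exact coordTensor_ambMetric hy

end Components

namespace IsGlobalAmbient

variable {lam : ℝ}

theorem isOpen_coordDomain (hA : A.IsGlobalAmbient lam) (x : M) : IsOpen (A.coordDomain x) := by
  rw [coordDomain_eq (0, x, 0)]
  exact (continuousOn_extChartAt_symm _).isOpen_inter_preimage (isOpen_extChartAt_target _)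
    hA.isOpen_carrier

theorem isSymm_leafMatrix (hA : A.IsGlobalAmbient lam) {p : ℝ × M × ℝ} (hp : p ∈ A.carrier) :
    (A.leafMatrix p.2.1 p.2.2 (extChartAt (𝓡 n) p.2.1 p.2.1)).IsSymm :=
  Matrix.IsSymm.ext fun i j => by
    rw [leafMatrix, coordTensor_self, coordTensor_self]
    exact hA.symm p hp _ _

variable [IsManifold (𝓡 n) ∞ M]

theorem isRegularOn (hA : A.IsGlobalAmbient lam) (x : M) :
    IsRegularOn (A.leafMatrix x) (A.coordDomain x) where
  isOpen := hA.isOpen_coordDomain x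
  contDiffOn i j := by
    have hsmooth := hA.smooth_metric (0, x, 0) (idxX i) (idxX j)
    rw [← coordDomain_eq (0, x, 0)] at hsmooth
    refine hsmooth.congr fun y hy => ?_
    rw [coordTensor_ambMetric (p := (0, x, 0)) (mem_extChartAt_amb_target.mpr hy.1)]
    rfl
  isUnit_det _ hy := isUnit_det_coordTensor hy.1 (hA.pos _ hy.2)

theorem contDiffOn_coordFun (hA : A.IsGlobalAmbient lam) (p : ℝ × M × ℝ) :
    ContDiffOn ℝ ∞ (coordFun (ambI n) (A.ambDensity lam) p) (A.coordDomain p.2.1) := by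
  rw [coordDomain_eq p]
  refine ((contMDiffOn_iff.mp hA.smooth_density).2 p 0).mono fun y hy => ⟨hy.1, hy.2, ?_⟩
  rw [extChartAt_model_space_eq_id]
  trivial

theorem differentiableAt_coordFun (hA : A.IsGlobalAmbient lam) {p : ℝ × M × ℝ} {y : AmbModel n}
    (hy : y ∈ A.coordDomain p.2.1) :
    DifferentiableAt ℝ (coordFun (ambI n) (A.ambDensity lam) p) y :=
  differentiableAt_of_contDiffOn (hA.isOpen_coordDomain _) (hA.contDiffOn_coordFun p) hy

theorem pd_v_density (hA : A.IsGlobalAmbient lam) {p : ℝ × M × ℝ} {y : AmbModel n}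
    (hy : y ∈ A.coordDomain p.2.1) :
    pd (ambBasis n) idxV (coordFun (ambI n) (A.ambDensity lam) p) y = -(1 - lam * y.2.2) := by
  have hderiv (a c v : ℝ) : HasDerivAt (fun v => a - v + c * v) (-1 + c * 1) v :=
    ((hasDerivAt_id v).const_sub a).add ((hasDerivAt_id v).const_mul c)
  rw [pd_v_eq_deriv (hA.differentiableAt_coordFun hy)]
  exact (hderiv (A.density y.2.2 ((extChartAt (𝓡 n) p.2.1).symm y.2.1)) (lam * y.2.2)
    y.1).deriv.trans (by ring)

theorem pd_u_pd_v_density (hA : A.IsGlobalAmbient lam) {p : ℝ × M × ℝ} {y : AmbModel n}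
    (hy : y ∈ A.coordDomain p.2.1) :
    pd (ambBasis n) idxU
      (pd (ambBasis n) idxV (coordFun (ambI n) (A.ambDensity lam) p)) y = lam := by
  have hpd : pd (ambBasis n) idxV (coordFun (ambI n) (A.ambDensity lam) p) =ᶠ[𝓝 y]
      fun z => -(1 - lam * z.2.2) := by
    filter_upwards [(hA.isOpen_coordDomain p.2.1).mem_nhds hy] with z hz using hA.pd_v_density hz
  have hderiv : HasDerivAt (fun u : ℝ => -(1 - lam * u)) (- -(lam * 1)) y.2.2 :=
    (((hasDerivAt_id _).const_mul lam).const_sub 1).neg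
  rw [pd_congr hpd, pd_u_eq_deriv (by fun_prop)]
  exact hderiv.deriv.trans (by ring)

theorem pd_u_leafMatrix (hA : A.IsGlobalAmbient lam) {p : ℝ × M × ℝ} (hp : p ∈ A.carrier)
    (i j : Fin n) :
    pd (ambBasis n) idxU (fun z => A.leafMatrix p.2.1 z.2.2 z.2.1 i j) (extChartAt (ambI n) p p) =
      A.metricDeriv p i j :=
  pd_u_eq_deriv ((hA.isRegularOn p.2.1).differentiableAt (extChartAt_amb_mem_coordDomain hp) i j)

theorem pd_u_density (hA : A.IsGlobalAmbient lam) {p : ℝ × M × ℝ} (hp : p ∈ A.carrier) :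
    pd (ambBasis n) idxU (coordFun (ambI n) (A.ambDensity lam) p) (extChartAt (ambI n) p p) =
      A.densityDeriv lam p := by
  rw [pd_u_eq_deriv (hA.differentiableAt_coordFun (extChartAt_amb_mem_coordDomain hp))]
  simp only [coordFun, extChartAt_amb, extChartAt_amb_symm, extChartAt_to_inv, densityDeriv]

theorem hessCoord_ambDensity_xx (hA : A.IsGlobalAmbient lam) {p : ℝ × M × ℝ} (hp : p ∈ A.carrier)
    (i j : Fin n) :
    hessCoord (ambBasis n) (normalField (A.leafMatrix p.2.1))
        (coordFun (ambI n) (A.ambDensity lam) p) (idxX i) (idxX j) (extChartAt (ambI n) p p) =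
      hessCoord (baseBasis n) (A.leafMatrix p.2.1 p.2.2)
        (coordFun (𝓡 n) (A.leafDensity lam p.1 p.2.2) p.2.1) i j (extChartAt (𝓡 n) p.2.1 p.2.1) -
      1 / 2 * (1 - lam * p.2.2) * A.metricDeriv p i j := by
  have hy := extChartAt_amb_mem_coordDomain hp
  rw [(hA.isRegularOn p.2.1).hessCoord_xx (hA.contDiffOn_coordFun p) hy, hA.pd_v_density hy,
    hA.pd_u_leafMatrix hp, mul_neg, neg_mul, ← sub_eq_add_neg]
  rfl

theorem leaf_ricciCoord_add_hessCoord (hA : A.IsGlobalAmbient lam) {p : ℝ × M × ℝ}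
    (hp : p ∈ A.carrier) (i j : Fin n) :
    ricciCoord (baseBasis n) (A.leafMatrix p.2.1 p.2.2) i j (extChartAt (𝓡 n) p.2.1 p.2.1) +
      hessCoord (baseBasis n) (A.leafMatrix p.2.1 p.2.2)
        (coordFun (𝓡 n) (A.leafDensity lam p.1 p.2.2) p.2.1) i j (extChartAt (𝓡 n) p.2.1 p.2.1) =
    1 / 2 * (1 - lam * p.2.2) * A.metricDeriv p i j +
      lam * A.leafMatrix p.2.1 p.2.2 (extChartAt (𝓡 n) p.2.1 p.2.1) i j := by
  have hG := coordTensor_ambMetric_eventuallyEq (A := A) p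
  have hP := hA.P_eq_zero p hp (ambBasis n (idxX i)) (ambBasis n (idxX j))
  unfold weightedP weightedRicci ricci hess at hP
  rw [evalComponents_basis, evalComponents_basis,
    ← coordTensor_self (I := ambI n) (b := ambBasis n), ricciCoord_congr hG, hessCoord_congr hG,
    hG.eq_of_nhds, (hA.isRegularOn p.2.1).ricciCoord_xx (extChartAt_amb_mem_coordDomain hp),
    hA.hessCoord_ambDensity_xx hp, normalField, normalMatrix_xx] at hP
  simp only [extChartAt_amb] at hP
  linear_combination hP

theorem weightedRicci_leaf (hA : A.IsGlobalAmbient lam) {p : ℝ × M × ℝ} (hp : p ∈ A.carrier)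
    (X Y : TangentSpace (𝓡 n) p.2.1) :
    weightedRicci (𝓡 n) (baseBasis n) (A.metric p.2.2) (A.leafDensity lam p.1 p.2.2) p.2.1 X Y =
      evalComponents (𝓡 n) (baseBasis n) p.2.1
        ((1 / 2 * (1 - lam * p.2.2)) • A.metricDeriv p +
          lam • A.leafMatrix p.2.1 p.2.2 (extChartAt (𝓡 n) p.2.1 p.2.1)) X Y := by
  rw [weightedRicci_eq_evalComponents]
  exact congrArg (evalComponents (𝓡 n) (baseBasis n) p.2.1 · X Y)
    (funext fun i => funext fun j => hA.leaf_ricciCoord_add_hessCoord hp i j)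

theorem isUnit_det_leafMatrix (hA : A.IsGlobalAmbient lam) {p : ℝ × M × ℝ} (hp : p ∈ A.carrier) :
    IsUnit (A.leafMatrix p.2.1 p.2.2 (extChartAt (𝓡 n) p.2.1 p.2.1)).det :=
  (hA.isRegularOn p.2.1).isUnit_det _ (extChartAt_amb_mem_coordDomain hp)

theorem scalar_add_laplacian_leaf (hA : A.IsGlobalAmbient lam) {p : ℝ × M × ℝ}
    (hp : p ∈ A.carrier) :
    scalar (𝓡 n) (baseBasis n) (A.metric p.2.2) p.2.1 +
        laplacian (𝓡 n) (baseBasis n) (A.metric p.2.2) (A.leafDensity lam p.1 p.2.2) p.2.1 =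
      1 / 2 * (1 - lam * p.2.2) *
        metricTrace (A.leafMatrix p.2.1 p.2.2 (extChartAt (𝓡 n) p.2.1 p.2.1)) (A.metricDeriv p) +
      lam * n := by
  have hself := metricTrace_self (hA.isUnit_det_leafMatrix hp) (hA.isSymm_leafMatrix hp)
  rw [Fintype.card_fin] at hself
  rw [scalar_eq_metricTrace, laplacian_eq_metricTrace, ← metricTrace_add, ← hself,
    ← metricTrace_smul, ← metricTrace_smul, ← metricTrace_add]
  exact congrArg _ (Matrix.ext (hA.leaf_ricciCoord_add_hessCoord hp))

theorem laplacian_ambDensity (hA : A.IsGlobalAmbient lam) {p : ℝ × M × ℝ} (hp : p ∈ A.carrier) :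
    laplacian (ambI n) (ambBasis n) A.ambMetric (A.ambDensity lam) p =
      laplacian (𝓡 n) (baseBasis n) (A.metric p.2.2) (A.leafDensity lam p.1 p.2.2) p.2.1 -
        1 / 2 * (1 - lam * p.2.2) *
          metricTrace (A.leafMatrix p.2.1 p.2.2 (extChartAt (𝓡 n) p.2.1 p.2.1)) (A.metricDeriv p) +
        2 * lam := by
  have hG := coordTensor_ambMetric_eventuallyEq (A := A) p
  have hreg := hA.isRegularOn p.2.1
  have hy := extChartAt_amb_mem_coordDomain hp
  simp only [laplacian_eq_metricTrace, hessCoord_congr hG, hG.eq_of_nhds]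
  rw [normalField, metricTrace_normalMatrix (hreg.isUnit_det _ hy), Matrix.of_apply,
    Matrix.of_apply, hreg.hessCoord_uv hy, hreg.hessCoord_vu (hA.contDiffOn_coordFun p) hy,
    hA.pd_u_pd_v_density hy, add_assoc, ← two_mul, sub_eq_add_neg, ← neg_mul,
    ← metricTrace_smul]
  change metricTrace (A.leafMatrix p.2.1 p.2.2 (extChartAt (𝓡 n) p.2.1 p.2.1)) _ + _ =
    metricTrace (A.leafMatrix p.2.1 p.2.2 (extChartAt (𝓡 n) p.2.1 p.2.1)) _ + _ + _
  rw [← metricTrace_add]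
  refine congrArg (· + 2 * lam) (congrArg (metricTrace _) (Matrix.ext fun i j => ?_))
  exact (hA.hessCoord_ambDensity_xx hp i j).trans
    ((sub_eq_add_neg _ _).trans (congrArg (_ + ·) (neg_mul _ _).symm))

theorem gradSq_ambDensity (hA : A.IsGlobalAmbient lam) {p : ℝ × M × ℝ} (hp : p ∈ A.carrier) :
    gradSq (ambI n) (ambBasis n) A.ambMetric (A.ambDensity lam) p =
      gradSq (𝓡 n) (baseBasis n) (A.metric p.2.2) (A.leafDensity lam p.1 p.2.2) p.2.1 -
        2 * (1 - lam * p.2.2) * A.densityDeriv lam p := by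
  have hG := coordTensor_ambMetric_eventuallyEq (A := A) p
  have hy := extChartAt_amb_mem_coordDomain hp
  have hx (i : Fin n) := pd_x_eq_pd (hA.differentiableAt_coordFun hy) i
  simp only [gradSq_eq_metricTrace, hG.eq_of_nhds]
  rw [normalField, metricTrace_normalMatrix ((hA.isRegularOn p.2.1).isUnit_det _ hy),
    Matrix.of_apply, Matrix.of_apply, hA.pd_u_density hp, hA.pd_v_density hy]
  have hleaf : (Matrix.of fun I J =>
      pd (ambBasis n) I (coordFun (ambI n) (A.ambDensity lam) p) (extChartAt (ambI n) p p) *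
        pd (ambBasis n) J (coordFun (ambI n) (A.ambDensity lam) p)
          (extChartAt (ambI n) p p)).submatrix idxX idxX =
      Matrix.of fun i j =>
        pd (baseBasis n) i (coordFun (𝓡 n) (A.leafDensity lam p.1 p.2.2) p.2.1)
          (extChartAt (𝓡 n) p.2.1 p.2.1) *
        pd (baseBasis n) j (coordFun (𝓡 n) (A.leafDensity lam p.1 p.2.2) p.2.1)
          (extChartAt (𝓡 n) p.2.1 p.2.1) :=
    Matrix.ext fun i j => congrArg₂ (· * ·) (hx i) (hx j)
  rw [hleaf]
  change metricTrace _ _ + _ * -(1 - lam * p.2.2) + -(1 - lam * p.2.2) * _ = metricTrace _ _ - _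
  simp only [extChartAt_amb, leafMatrix]
  ring

theorem densityDeriv_eq (hA : A.IsGlobalAmbient lam) {p : ℝ × M × ℝ} (hp : p ∈ A.carrier) :
    2 * (1 - lam * p.2.2) * A.densityDeriv lam p =
      scalar (𝓡 n) (baseBasis n) (A.metric p.2.2) p.2.1 +
        gradSq (𝓡 n) (baseBasis n) (A.metric p.2.2) (A.leafDensity lam p.1 p.2.2) p.2.1 -
        2 * lam * A.ambDensity lam p := by
  have hF := hA.F_eq_zero p hp
  rw [weightedF, hA.laplacian_ambDensity hp, hA.gradSq_ambDensity hp] at hF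
  have htrace := hA.scalar_add_laplacian_leaf hp
  simp only [Fintype.card_sum, Fintype.card_unit, Fintype.card_fin, Nat.cast_add,
    Nat.cast_one] at hF
  linear_combination hF - htrace

end IsGlobalAmbient

end NormalSpace

/-! ### The slices as homothetic copies -/

section Dilation

variable {n : ℕ} {c : ℝ}

/-- The linear map `(v, x, w) ↦ (v, x, w / c)` of the model space. -/
def dilation (n : ℕ) (hc : c ≠ 0) : AmbModel n ≃L[ℝ] AmbModel n :=
  (ContinuousLinearEquiv.refl ℝ ℝ).prodCongr
    ((ContinuousLinearEquiv.refl ℝ (EuclideanSpace ℝ (Fin n))).prodCongr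
      (LinearEquiv.smulOfNeZero ℝ ℝ c⁻¹ (inv_ne_zero hc)).toContinuousLinearEquiv)

/-- The eigenvalues of `dilation` on the basis `∂_v, ∂_i, ∂_u`. -/
def dilationWeight (n : ℕ) (c : ℝ) : AmbIndex n → ℝ
  | .inl _ => 1
  | .inr (.inl _) => 1
  | .inr (.inr _) => c⁻¹

theorem dilation_apply (hc : c ≠ 0) (y : AmbModel n) :
    dilation n hc y = (y.1, y.2.1, y.2.2 / c) := by
  rw [div_eq_inv_mul]
  rfl

theorem dilation_basis (hc : c ≠ 0) (I : AmbIndex n) :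
    dilation n hc (ambBasis n I) = dilationWeight n c I • ambBasis n I := by
  rcases I with ⟨⟨⟩⟩ | I | ⟨⟨⟩⟩ <;> simp [dilation_apply, dilationWeight]

/-- The map `(v, x, w) ↦ (v, x, w / c)`, which for `c = 1 - s / τ` takes the normal coordinates
`(v, x, u(s))` to `(v, x, u)`. -/
def rescale {M : Type*} (c : ℝ) (p : ℝ × M × ℝ) : ℝ × M × ℝ := (p.1, p.2.1, p.2.2 / c)

theorem deriv_comp_div (f : ℝ → ℝ) (c x : ℝ) :
    deriv (fun u => f (u / c)) x = c⁻¹ * deriv f (x / c) := by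
  simp only [div_eq_inv_mul]
  exact deriv_comp_mul_left c⁻¹ f x

end Dilation

namespace NormalSpace

theorem lamAt_eq (τ s : ℝ) : lamAt τ s = (2 * τ)⁻¹ / (1 - s / τ) := by
  rw [lamAt, tauAt, mul_inv, mul_inv, div_eq_mul_inv, mul_inv]
  ring

theorem lamAt_mul (τ s w : ℝ) : lamAt τ s * w = (2 * τ)⁻¹ * (w / (1 - s / τ)) := by
  rw [lamAt_eq, div_mul_eq_mul_div, mul_div_assoc]

theorem uAt_div {τ s : ℝ} (hc : 1 - s / τ ≠ 0) (u : ℝ) : uAt τ s u / (1 - s / τ) = u :=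
  mul_div_cancel_left₀ u hc

theorem lamAt_mul_uAt {τ s : ℝ} (hc : 1 - s / τ ≠ 0) (u : ℝ) :
    lamAt τ s * uAt τ s u = (2 * τ)⁻¹ * u := by
  rw [lamAt_mul, uAt_div hc]

theorem rescale_uAt {M : Type*} {τ s : ℝ} (hc : 1 - s / τ ≠ 0) (p : ℝ × M × ℝ) :
    rescale (1 - s / τ) (p.1, p.2.1, uAt τ s p.2.2) = p := by
  simp only [rescale, uAt_div hc]

variable {n : ℕ} {M : Type*} [TopologicalSpace M] [ChartedSpace (EuclideanSpace ℝ (Fin n)) M]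

theorem continuous_rescale (c : ℝ) : Continuous (rescale (M := M) c) := by
  unfold rescale
  fun_prop

theorem contMDiff_rescale (c : ℝ) : ContMDiff (ambI n) (ambI n) ∞ (rescale (M := M) c) :=
  contMDiff_fst.prodMk ((contMDiff_fst.comp contMDiff_snd).prodMk
    ((contDiff_id.div_const c).contMDiff.comp (contMDiff_snd.comp contMDiff_snd)))

section Slice

variable (A : NormalSpace n M) {τ s : ℝ}

theorem slice_ambDensity :
    (A.slice τ s).ambDensity (lamAt τ s) = A.ambDensity (2 * τ)⁻¹ ∘ rescale (1 - s / τ) := by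
  ext p
  simp only [ambDensity, slice, Function.comp_apply, rescale, lamAt_mul]

theorem slice_leafMatrix (x : M) (w : ℝ) (ξ : EuclideanSpace ℝ (Fin n)) :
    (A.slice τ s).leafMatrix x w ξ = (1 - s / τ) • A.leafMatrix x (w / (1 - s / τ)) ξ := rfl

theorem slice_normalField (hc : 1 - s / τ ≠ 0) (x : M) (y : AmbModel n) (I J : AmbIndex n) :
    normalField ((A.slice τ s).leafMatrix x) y I J =
      (1 - s / τ) * (dilationWeight n (1 - s / τ) I * dilationWeight n (1 - s / τ) J) *
        normalField (A.leafMatrix x) (dilation n hc y) I J := by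
  rw [dilation_apply]
  rcases I with ⟨⟨⟩⟩ | I | ⟨⟨⟩⟩ <;> rcases J with ⟨⟨⟩⟩ | J | ⟨⟨⟩⟩ <;>
    simp [normalField, dilationWeight, slice_leafMatrix, hc]

theorem isHomothety_rescale (hc : 1 - s / τ ≠ 0) :
    IsHomothety (ambI n) (ambBasis n) (rescale (1 - s / τ)) (dilation n hc)
      (dilationWeight n (1 - s / τ)) (1 - s / τ) (A.slice τ s).ambMetric A.ambMetric where
  chart_apply p q := (dilation_apply hc (extChartAt (ambI n) p q)).symm
  chart_symm_apply p y := congrArg (extChartAt (ambI n) (rescale _ p)).symm (dilation_apply hc y)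
  map_basis := dilation_basis hc
  factor_ne_zero := hc
  pullback q X Y := by
    refine (ambMetric_apply q X Y).trans ?_
    refine Eq.trans ?_ (congrArg ((1 - s / τ) * ·)
      (ambMetric_apply (rescale (1 - s / τ) q) (dilation n hc X) (dilation n hc Y)).symm)
    have hform : (A.slice τ s).leafForm q.2.2 q.2.1 X.2.1 Y.2.1 =
        (1 - s / τ) * A.leafForm (q.2.2 / (1 - s / τ)) q.2.1 X.2.1 Y.2.1 := rfl
    rw [hform, dilation_apply, dilation_apply]
    simp only [rescale]
    field_simp

theorem slice_metricDeriv (hc : 1 - s / τ ≠ 0) (p : ℝ × M × ℝ) :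
    (A.slice τ s).metricDeriv p = A.metricDeriv (rescale (1 - s / τ) p) := by
  ext i j
  simp only [metricDeriv, Matrix.of_apply, slice_leafMatrix, Matrix.smul_apply, smul_eq_mul,
    deriv_const_mul_field', rescale]
  rw [deriv_comp_div (fun u => A.leafMatrix p.2.1 u _ i j)]
  field_simp

theorem slice_densityDeriv (p : ℝ × M × ℝ) :
    (A.slice τ s).densityDeriv (lamAt τ s) p =
      (1 - s / τ)⁻¹ * A.densityDeriv (2 * τ)⁻¹ (rescale (1 - s / τ) p) := by
  rw [densityDeriv, slice_ambDensity]
  exact deriv_comp_div (fun u => A.ambDensity (2 * τ)⁻¹ (p.1, p.2.1, u)) _ _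

end Slice

namespace IsGlobalAmbient

variable {A : NormalSpace n M} {τ s : ℝ}

theorem weightedP_slice (hA : A.IsGlobalAmbient (2 * τ)⁻¹) (hc : 1 - s / τ ≠ 0) {p : ℝ × M × ℝ}
    (hp : p ∈ (A.slice τ s).carrier) (X Y : TangentSpace (ambI n) p) :
    weightedP (ambI n) (ambBasis n) (A.slice τ s).ambMetric
      ((A.slice τ s).ambDensity (lamAt τ s)) (lamAt τ s) p X Y = 0 := by
  rw [slice_ambDensity, lamAt_eq]
  exact ((A.isHomothety_rescale hc).weightedP_comp _ _ p X Y).trans (hA.P_eq_zero _ hp _ _)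

theorem weightedF_slice (hA : A.IsGlobalAmbient (2 * τ)⁻¹) (hc : 1 - s / τ ≠ 0) {p : ℝ × M × ℝ}
    (hp : p ∈ (A.slice τ s).carrier) :
    weightedF (ambI n) (ambBasis n) (A.slice τ s).ambMetric
      ((A.slice τ s).ambDensity (lamAt τ s)) (lamAt τ s) p = 0 := by
  rw [slice_ambDensity, lamAt_eq]
  exact ((A.isHomothety_rescale hc).weightedF_comp _ _ p).trans
    ((congrArg _ (hA.F_eq_zero _ hp)).trans (mul_zero _))

theorem mem_slice (hc : 1 - s / τ ≠ 0) {p : ℝ × M × ℝ} (hp : p ∈ A.carrier) :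
    (p.1, p.2.1, uAt τ s p.2.2) ∈ (A.slice τ s).carrier := by
  change rescale (1 - s / τ) (p.1, p.2.1, uAt τ s p.2.2) ∈ A.carrier
  rwa [rescale_uAt hc]

variable [IsManifold (𝓡 n) ∞ M]

theorem isSmoothOn_slice (hA : A.IsGlobalAmbient (2 * τ)⁻¹) (hc : 1 - s / τ ≠ 0) :
    IsSmoothOn (ambI n) (ambBasis n) (A.slice τ s).ambMetric (A.slice τ s).carrier := by
  intro p I J
  rw [← coordDomain_eq p]
  have hmaps : Set.MapsTo (dilation n hc) ((A.slice τ s).coordDomain p.2.1)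
      (A.coordDomain p.2.1) := fun y hy => by
    rw [dilation_apply]
    exact hy
  refine ((contDiffOn_const (c := (1 - s / τ) *
    (dilationWeight n (1 - s / τ) I * dilationWeight n (1 - s / τ) J))).mul
      (((hA.isRegularOn p.2.1).contDiffOn_normalField I J).comp
        (dilation n hc).contDiff.contDiffOn hmaps)).congr fun y hy => ?_
  rw [coordTensor_ambMetric (mem_extChartAt_amb_target.mpr hy.1), A.slice_normalField hc]
  rfl

theorem slice (hA : A.IsGlobalAmbient (2 * τ)⁻¹) (hs : 0 < 1 - s / τ) :
    (A.slice τ s).IsGlobalAmbient (lamAt τ s) where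
  isOpen_carrier := hA.isOpen_carrier.preimage (continuous_rescale (1 - s / τ))
  zero_mem v x := by
    simpa only [NormalSpace.slice, Set.mem_ofPred_eq, zero_div] using hA.zero_mem v x
  interval v x := (hA.interval v x).preimage_mono fun _ _ hab =>
    div_le_div_of_nonneg_right hab hs.le
  dilation_defined p hp := by
    rw [lamAt_mul]
    exact hA.dilation_defined _ hp
  dilation_mem p hp t := by
    rw [lamAt_mul]
    exact hA.dilation_mem _ hp t
  symm _ hp X Y := congrArg ((1 - s / τ) * ·) (hA.symm _ hp X Y)
  pos _ hp X hX := mul_pos hs (hA.pos _ hp X hX)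
  smooth_metric := hA.isSmoothOn_slice hs.ne'
  smooth_density := by
    rw [slice_ambDensity]
    exact hA.smooth_density.comp (contMDiff_rescale _).contMDiffOn fun _ hp => hp
  P_eq_zero _ hp := hA.weightedP_slice hs.ne' hp
  F_eq_zero _ hp := hA.weightedF_slice hs.ne' hp

theorem weightedRicci_slice (hA : A.IsGlobalAmbient (2 * τ)⁻¹) (hs : 0 < 1 - s / τ)
    {p : ℝ × M × ℝ} (hp : p ∈ A.carrier) (X Y : TangentSpace (𝓡 n) p.2.1) :
    weightedRicci (𝓡 n) (baseBasis n) ((A.slice τ s).metric (uAt τ s p.2.2))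
        ((A.slice τ s).leafDensity (lamAt τ s) p.1 (uAt τ s p.2.2)) p.2.1 X Y =
      evalComponents (𝓡 n) (baseBasis n) p.2.1
        ((1 / 2 * (1 - (2 * τ)⁻¹ * p.2.2)) • A.metricDeriv p +
          (2 * τ)⁻¹ • A.leafMatrix p.2.1 p.2.2 (extChartAt (𝓡 n) p.2.1 p.2.1)) X Y := by
  have hlam : lamAt τ s * (1 - s / τ) = (2 * τ)⁻¹ := by
    rw [lamAt_eq, div_mul_cancel₀ _ hs.ne']
  rw [(hA.slice hs).weightedRicci_leaf (mem_slice hs.ne' hp), slice_metricDeriv A hs.ne',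
    rescale_uAt hs.ne', slice_leafMatrix, smul_smul]
  simp only [uAt_div hs.ne', lamAt_mul_uAt hs.ne', hlam]

theorem densityDeriv_slice (hA : A.IsGlobalAmbient (2 * τ)⁻¹) (hs : 0 < 1 - s / τ)
    {p : ℝ × M × ℝ} (hp : p ∈ A.carrier) :
    2 * (1 - (2 * τ)⁻¹ * p.2.2) * ((1 - s / τ)⁻¹ * A.densityDeriv (2 * τ)⁻¹ p) =
      scalar (𝓡 n) (baseBasis n) ((A.slice τ s).metric (uAt τ s p.2.2)) p.2.1 +
        gradSq (𝓡 n) (baseBasis n) ((A.slice τ s).metric (uAt τ s p.2.2))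
          ((A.slice τ s).leafDensity (lamAt τ s) p.1 (uAt τ s p.2.2)) p.2.1 -
        2 * lamAt τ s * (A.slice τ s).ambDensity (lamAt τ s) (p.1, p.2.1, uAt τ s p.2.2) := by
  have h := (hA.slice hs).densityDeriv_eq (mem_slice hs.ne' hp)
  rwa [slice_densityDeriv, rescale_uAt hs.ne', lamAt_mul_uAt hs.ne'] at h

end IsGlobalAmbient

end NormalSpace

/-! ### The total space -/

section TotalSpace

variable {n : ℕ}

/-- The model vector space of `(ℝ × M × ℝ) × ℝ`. -/
abbrev TotModel (n : ℕ) : Type := AmbModel n × ℝ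

/-- The index set of the coordinates `v, xⁱ, u, s`. -/
abbrev TotIndex (n : ℕ) : Type := AmbIndex n ⊕ Unit

/-- The matrix, in the basis `∂_v, ∂_i, ∂_u, ∂_s`, of the form with matrix `g` along `M` that
annihilates `∂_v, ∂_u, ∂_s`. -/
def totMatrix (g : Matrix (Fin n) (Fin n) ℝ) : Matrix (TotIndex n) (TotIndex n) ℝ
  | .inl (.inr (.inl i)), .inl (.inr (.inl j)) => g i j
  | _, _ => 0

theorem totBasis_inl (I : AmbIndex n) : totBasis n (.inl I) = (ambBasis n I, 0) := by
  simp [totBasis]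

theorem totBasis_inr : totBasis n (.inr ()) = (0, 1) := by
  simp [totBasis]

theorem totBasis_repr_x (Z : TotModel n) (i : Fin n) :
    (totBasis n).repr Z (.inl (idxX i)) = (baseBasis n).repr (dx n Z.1) i := by
  simp [totBasis, ambBasis, dx]

theorem fderiv_amb_apply (F : AmbModel n → ℝ) (y : AmbModel n) (α β : ℝ) :
    fderiv ℝ F y (α, 0, β) =
      α * pd (ambBasis n) idxV F y + β * pd (ambBasis n) idxU F y := by
  have hvec : ((α, 0, β) : AmbModel n) = α • ambBasis n idxV + β • ambBasis n idxU := by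
    simp
  rw [hvec, map_add, map_smul, map_smul]
  rfl

theorem fderiv_scaled_apply {V : Type*} [NormedAddCommGroup V] [NormedSpace ℝ V] {a : V → ℝ}
    {y : V × ℝ} (ha : DifferentiableAt ℝ a y.1) (τ : ℝ) (Z : V × ℝ) :
    fderiv ℝ (fun z : V × ℝ => (1 - z.2 / τ) * a z.1) y Z =
      (1 - y.2 / τ) * fderiv ℝ a y.1 Z.1 - Z.2 / τ * a y.1 := by
  have hscale : HasFDerivAt (fun z : V × ℝ => 1 - z.2 * τ⁻¹)
      (-(τ⁻¹ • ContinuousLinearMap.snd ℝ V ℝ)) y :=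
    (HasFDerivAt.mul_const hasFDerivAt_snd τ⁻¹).const_sub 1
  have hmul := hscale.mul (HasFDerivAt.comp y ha.hasFDerivAt hasFDerivAt_fst)
  simp only [div_eq_mul_inv]
  refine (DFunLike.congr_fun hmul.fderiv Z).trans ?_
  simp only [Function.comp_apply, smul_neg, add_apply, smul_apply, ContinuousLinearMap.comp_apply,
    ContinuousLinearMap.coe_fst', smul_eq_mul, neg_apply, ContinuousLinearMap.coe_snd']
  ring

end TotalSpace

namespace NormalSpace

variable {n : ℕ} {M : Type*} [TopologicalSpace M] [ChartedSpace (EuclideanSpace ℝ (Fin n)) M]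

theorem extChartAt_tot_symm (P : (ℝ × M × ℝ) × ℝ) (y : TotModel n) :
    (extChartAt (totI n) P).symm y = ((extChartAt (ambI n) P.1).symm y.1, y.2) := rfl

theorem hasFDerivAt_tot_coordChange {P Q : (ℝ × M × ℝ) × ℝ} {y : TotModel n}
    {D : EuclideanSpace ℝ (Fin n) →L[ℝ] EuclideanSpace ℝ (Fin n)}
    (hD : HasFDerivAt (fun z => extChartAt (𝓡 n) Q.1.2.1 ((extChartAt (𝓡 n) P.1.2.1).symm z)) D
      y.1.2.1) :
    HasFDerivAt (fun z => extChartAt (totI n) Q ((extChartAt (totI n) P).symm z))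
      (((ContinuousLinearMap.id ℝ ℝ).prodMap (D.prodMap (ContinuousLinearMap.id ℝ ℝ))).prodMap
        (ContinuousLinearMap.id ℝ ℝ)) y :=
  HasFDerivAt.prodMap (f₂ := id) y (hasFDerivAt_amb_coordChange (p := P.1) (q := Q.1) hD)
    (hasFDerivAt_id _)

theorem eventually_mem_target (P : (ℝ × M × ℝ) × ℝ) :
    ∀ᶠ y in 𝓝 (extChartAt (totI n) P P), y.1.2.1 ∈ (extChartAt (𝓡 n) P.1.2.1).target :=
  (show Continuous fun y : TotModel n => y.1.2.1 by fun_prop).continuousAt.eventually_mem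
    (extChartAt_target_mem_nhds (I := 𝓡 n) P.1.2.1)

theorem eventually_one_sub_div_ne_zero {τ : ℝ} {X : Type*} [TopologicalSpace X] {P : X × ℝ}
    (hc : 1 - P.2 / τ ≠ 0) : ∀ᶠ Q in 𝓝 P, 1 - Q.2 / τ ≠ 0 :=
  (continuousAt_const.sub (continuousAt_snd.div_const τ)).eventually_ne hc

theorem evalComponents_totMatrix (P : (ℝ × M × ℝ) × ℝ) (g : Matrix (Fin n) (Fin n) ℝ)
    (X Z : TangentSpace (totI n) P) :
    evalComponents (totI n) (totBasis n) P (totMatrix g) X Z =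
      evalComponents (𝓡 n) (baseBasis n) P.1.2.1 g (dx n X.1) (dx n Z.1) := by
  simp only [evalComponents, Fintype.sum_sum_type, totMatrix, zero_mul, Finset.sum_const_zero,
    add_zero, zero_add]
  exact Finset.sum_congr rfl fun i _ => Finset.sum_congr rfl fun j _ =>
    congrArg₂ (g i j * · * ·) (totBasis_repr_x X i) (totBasis_repr_x Z j)

variable (A : NormalSpace n M) {τ : ℝ}

theorem totDensity_eq {P : (ℝ × M × ℝ) × ℝ} (hc : 1 - P.2 / τ ≠ 0) :
    A.totDensity τ P = A.ambDensity (2 * τ)⁻¹ P.1 := by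
  rw [totDensity, slice_ambDensity, Function.comp_apply, rescale_uAt hc]

theorem lieFun_totTau (hτ : τ ≠ 0) (P : (ℝ × M × ℝ) × ℝ) :
    lieFun (totI n) (A.flowField τ) (totTau M τ) P = -1 := by
  have hderiv : HasDerivAt (tauAt τ) (-(1 / τ) * τ) P.2 :=
    (((hasDerivAt_id P.2).div_const τ).const_sub 1).mul_const τ
  have hcomp : HasMFDerivAt (totI n) 𝓘(ℝ, ℝ) (totTau M τ) P _ :=
    HasMFDerivAt.comp P hderiv.hasFDerivAt.hasMFDerivAt
      (hasMFDerivAt_snd (I := ambI n) (I' := 𝓘(ℝ, ℝ)) P)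
  rw [lieFun, hcomp.mfderiv]
  change (1 : ℝ) * (-(1 / τ) * τ) = -1
  field_simp

section

variable [IsManifold (𝓡 n) ∞ M]

theorem coordTensor_totMetric {P : (ℝ × M × ℝ) × ℝ} (hc : 1 - P.2 / τ ≠ 0) :
    coordTensor (totI n) (totBasis n) (A.totMetric τ) P =ᶠ[𝓝 (extChartAt (totI n) P P)]
      fun y => totMatrix ((1 - y.2 / τ) • A.leafMatrix P.1.2.1 y.1.2.2 y.1.2.1) := by
  filter_upwards [eventually_mem_target P,
    eventually_one_sub_div_ne_zero (P := extChartAt (totI n) P P) hc] with y hy hcy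
  obtain ⟨D, hD⟩ : ∃ D, HasFDerivAt (fun z => extChartAt (𝓡 n)
      ((extChartAt (𝓡 n) P.1.2.1).symm y.1.2.1) ((extChartAt (𝓡 n) P.1.2.1).symm z)) D y.1.2.1 :=
    ⟨_, hasFDerivAt_coordChange hy (mem_extChartAt_source _)⟩
  have hleaf (i j : Fin n) : (1 - y.2 / τ) * A.leafMatrix P.1.2.1 y.1.2.2 y.1.2.1 i j =
      (A.slice τ y.2).leafForm (uAt τ y.2 y.1.2.2) ((extChartAt (𝓡 n) P.1.2.1).symm y.1.2.1)
        (D (baseBasis n i)) (D (baseBasis n j)) := by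
    change _ = (1 - y.2 / τ) * A.leafForm (uAt τ y.2 y.1.2.2 / (1 - y.2 / τ)) _ _ _
    rw [uAt_div hcy]
    exact congrArg ((1 - y.2 / τ) * ·) (coordTensor_apply rfl hD.fderiv i j)
  ext I J
  refine (coordTensor_apply (extChartAt_tot_symm P y) (hasFDerivAt_tot_coordChange (P := P)
    (Q := ((y.1.1, (extChartAt (𝓡 n) P.1.2.1).symm y.1.2.1, y.1.2.2), y.2)) hD).fderiv
      I J).trans ?_
  change (A.slice τ y.2).leafForm (uAt τ y.2 y.1.2.2) ((extChartAt (𝓡 n) P.1.2.1).symm y.1.2.1)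
    (D (totBasis n I).1.2.1) (D (totBasis n J).1.2.1) = _
  rcases I with (⟨⟨⟩⟩ | I | ⟨⟨⟩⟩) | ⟨⟨⟩⟩ <;> rcases J with (⟨⟨⟩⟩ | J | ⟨⟨⟩⟩) | ⟨⟨⟩⟩ <;>
    simp [totMatrix, totBasis_inl, totBasis_inr, hleaf]

theorem coordField_x_eventually_eq_zero (Y : (Q : (ℝ × M × ℝ) × ℝ) → TangentSpace (totI n) Q)
    (hY : ∀ Q, dx n (Y Q).1 = 0) (P : (ℝ × M × ℝ) × ℝ) (k : Fin n) :
    ∀ᶠ y in 𝓝 (extChartAt (totI n) P P),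
      coordField (totI n) (totBasis n) Y P (.inl (idxX k)) y = 0 := by
  filter_upwards [eventually_mem_target P] with y hy
  let Q : (ℝ × M × ℝ) × ℝ := ((y.1.1, (extChartAt (𝓡 n) P.1.2.1).symm y.1.2.1, y.1.2.2), y.2)
  obtain ⟨D, hD⟩ : ∃ D, HasFDerivAt (fun z => extChartAt (𝓡 n) P.1.2.1
      ((extChartAt (𝓡 n) Q.1.2.1).symm z)) D (extChartAt (𝓡 n) Q.1.2.1 Q.1.2.1) :=
    ⟨_, hasFDerivAt_coordChange (mem_extChartAt_target _) (by
      rw [extChartAt_to_inv]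
      exact (extChartAt (𝓡 n) P.1.2.1).map_target hy)⟩
  refine (coordField_apply (extChartAt_tot_symm P y)
    (hasFDerivAt_tot_coordChange (P := Q) (Q := P) hD).fderiv _).trans
      ((totBasis_repr_x _ k).trans ?_)
  change (baseBasis n).repr (D (dx n (Y Q).1)) k = 0
  rw [hY, map_zero, map_zero]
  rfl

end

namespace IsGlobalAmbient

variable {A}

theorem hasMFDerivAt_ambDensity {lam : ℝ} (hA : A.IsGlobalAmbient lam) {p : ℝ × M × ℝ}
    (hp : p ∈ A.carrier) :
    HasMFDerivAt (ambI n) 𝓘(ℝ, ℝ) (A.ambDensity lam) p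
      (fderiv ℝ (coordFun (ambI n) (A.ambDensity lam) p) (extChartAt (ambI n) p p) :
        AmbModel n →L[ℝ] ℝ) := by
  have hd : MDifferentiableAt (ambI n) 𝓘(ℝ, ℝ) (A.ambDensity lam) p :=
    (hA.smooth_density.contMDiffAt (hA.isOpen_carrier.mem_nhds hp)).mdifferentiableAt (by simp)
  have hmfderiv := hd.mfderiv
  rw [(ambI n).range_eq_univ, fderivWithin_univ] at hmfderiv
  exact hmfderiv ▸ hd.hasMFDerivAt

variable [IsManifold (𝓡 n) ∞ M] {s : ℝ}

theorem fderiv_leafMatrix_flowField (hA : A.IsGlobalAmbient (2 * τ)⁻¹) (hc : 1 - s / τ ≠ 0)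
    {p : ℝ × M × ℝ} (hp : p ∈ A.carrier) (i j : Fin n) :
    fderiv ℝ (fun y : TotModel n => (1 - y.2 / τ) * A.leafMatrix p.2.1 y.1.2.2 y.1.2.1 i j)
      (extChartAt (totI n) (p, s) (p, s)) (A.flowField τ (p, s)) =
    -(1 - (2 * τ)⁻¹ * p.2.2) * A.metricDeriv p i j -
      τ⁻¹ * A.leafMatrix p.2.1 p.2.2 (extChartAt (𝓡 n) p.2.1 p.2.1) i j := by
  have hdiff := (hA.isRegularOn p.2.1).differentiableAt (extChartAt_amb_mem_coordDomain hp) i j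
  have hv : pd (ambBasis n) idxV (fun z => A.leafMatrix p.2.1 z.2.2 z.2.1 i j)
      (extChartAt (ambI n) p p) = 0 := pd_v_eq_zero (fun _ _ _ _ => rfl) _
  refine (fderiv_scaled_apply (y := extChartAt (totI n) (p, s) (p, s)) hdiff τ _).trans ?_
  refine (congrArg (_ * · - _) (fderiv_amb_apply _ _ _ _)).trans ?_
  refine (congrArg (_ * · - _) (congrArg₂ (_ * · + _ * ·) hv (hA.pd_u_leafMatrix hp i j))).trans ?_
  change (1 - s / τ) * (_ * 0 + -(1 - lamAt τ s * uAt τ s p.2.2) * (1 - s / τ)⁻¹ *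
    A.metricDeriv p i j) - 1 / τ * A.leafMatrix p.2.1 p.2.2 (extChartAt (𝓡 n) p.2.1 p.2.1) i j = _
  rw [lamAt_mul_uAt hc]
  linear_combination -(1 - (2 * τ)⁻¹ * p.2.2) * A.metricDeriv p i j * mul_inv_cancel₀ hc

theorem fderiv_totMatrix_flowField (hA : A.IsGlobalAmbient (2 * τ)⁻¹) (hc : 1 - s / τ ≠ 0)
    {p : ℝ × M × ℝ} (hp : p ∈ A.carrier) (I J : TotIndex n) :
    fderiv ℝ (fun y : TotModel n => totMatrix
        ((1 - y.2 / τ) • A.leafMatrix p.2.1 y.1.2.2 y.1.2.1) I J)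
      (extChartAt (totI n) (p, s) (p, s)) (A.flowField τ (p, s)) =
    totMatrix (-(1 - (2 * τ)⁻¹ * p.2.2) • A.metricDeriv p -
      τ⁻¹ • A.leafMatrix p.2.1 p.2.2 (extChartAt (𝓡 n) p.2.1 p.2.1)) I J := by
  rcases I with (I | I | I) | I <;> rcases J with (J | J | J) | J
  case inl.inr.inl.inl.inr.inl => exact hA.fderiv_leafMatrix_flowField hc hp I J
  all_goals
    simp only [totMatrix, fderiv_const_apply]
    rfl

theorem lieTensor_totMetric (hA : A.IsGlobalAmbient (2 * τ)⁻¹) (hs : 0 < 1 - s / τ)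
    {p : ℝ × M × ℝ} (hp : p ∈ A.carrier) (X Z : TangentSpace (totI n) (p, s)) :
    lieTensor (totI n) (totBasis n) (A.flowField τ) (A.totMetric τ) (p, s) X Z =
      -2 * weightedRicci (𝓡 n) (baseBasis n) ((A.slice τ s).metric (uAt τ s p.2.2))
        ((A.slice τ s).leafDensity (lamAt τ s) p.1 (uAt τ s p.2.2)) p.2.1
        (dx n X.1) (dx n Z.1) := by
  have hG := A.coordTensor_totMetric (P := (p, s)) hs.ne'
  have hderiv : (fun I J => fderiv ℝ (fun y =>
      coordTensor (totI n) (totBasis n) (A.totMetric τ) (p, s) y I J)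
        (extChartAt (totI n) (p, s) (p, s)) (A.flowField τ (p, s))) =
      totMatrix (-(1 - (2 * τ)⁻¹ * p.2.2) • A.metricDeriv p -
        τ⁻¹ • A.leafMatrix p.2.1 p.2.2 (extChartAt (𝓡 n) p.2.1 p.2.1)) :=
    funext fun I => funext fun J =>
      (DFunLike.congr_fun (hG.fun_comp (· I J)).fderiv_eq _).trans
        (hA.fderiv_totMatrix_flowField hs.ne' hp I J)
  have hmatrix : -(1 - (2 * τ)⁻¹ * p.2.2) • A.metricDeriv p -
      τ⁻¹ • A.leafMatrix p.2.1 p.2.2 (extChartAt (𝓡 n) p.2.1 p.2.1) =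
      (-2 : ℝ) • ((1 / 2 * (1 - (2 * τ)⁻¹ * p.2.2)) • A.metricDeriv p +
        (2 * τ)⁻¹ • A.leafMatrix p.2.1 p.2.2 (extChartAt (𝓡 n) p.2.1 p.2.1)) := by
    rw [mul_inv]
    module
  rw [lieTensor_eq_evalComponents_fderiv, hderiv]
  · refine (evalComponents_totMatrix _ _ X Z).trans ?_
    rw [hmatrix]
    exact (mul_evalComponents _ _ _ _ _).symm.trans
      (congrArg (-2 * ·) (hA.weightedRicci_slice hs hp _ _).symm)
  · rintro ((K | k | K) | K)
    case inl.inr.inl =>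
      exact .inr (coordField_x_eventually_eq_zero _ (fun _ => rfl) _ k)
    all_goals
      refine .inl fun I => ?_
      rw [hG.eq_of_nhds]
      rcases I with (I | I | I) | I <;> exact ⟨rfl, rfl⟩

theorem lieFun_totDensity (hA : A.IsGlobalAmbient (2 * τ)⁻¹) (hs : 0 < 1 - s / τ)
    {p : ℝ × M × ℝ} (hp : p ∈ A.carrier) :
    lieFun (totI n) (A.flowField τ) (A.totDensity τ) (p, s) =
      -scalar (𝓡 n) (baseBasis n) ((A.slice τ s).metric (uAt τ s p.2.2)) p.2.1
        - laplacian (𝓡 n) (baseBasis n) ((A.slice τ s).metric (uAt τ s p.2.2))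
            ((A.slice τ s).leafDensity (lamAt τ s) p.1 (uAt τ s p.2.2)) p.2.1
        + n / (2 * tauAt τ s) := by
  have hdensity : A.totDensity τ =ᶠ[𝓝 (p, s)] A.ambDensity (2 * τ)⁻¹ ∘ Prod.fst :=
    (eventually_one_sub_div_ne_zero hs.ne').mono fun _ hQ => A.totDensity_eq hQ
  have hcomp : HasMFDerivAt (totI n) 𝓘(ℝ, ℝ) (A.ambDensity (2 * τ)⁻¹ ∘ Prod.fst) (p, s) _ :=
    HasMFDerivAt.comp (p, s) (hA.hasMFDerivAt_ambDensity hp)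
      (hasMFDerivAt_fst (I := ambI n) (I' := 𝓘(ℝ, ℝ)) (p, s))
  have hne : 1 - (2 * τ)⁻¹ * p.2.2 ≠ 0 := fun h => hA.dilation_defined p hp (by linarith)
  rw [lieFun, hdensity.mfderiv_eq, hcomp.mfderiv]
  refine (fderiv_amb_apply _ _ _ _).trans ?_
  rw [hA.pd_v_density (extChartAt_amb_mem_coordDomain hp), hA.pd_u_density hp,
    lamAt_mul_uAt hs.ne']
  have hu := hA.densityDeriv_slice hs hp
  have hv₁ : A.totV₁ τ (p, s) = (1 / 2) * (
      scalar (𝓡 n) (baseBasis n) ((A.slice τ s).metric (uAt τ s p.2.2)) p.2.1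
      + 2 * laplacian (𝓡 n) (baseBasis n) ((A.slice τ s).metric (uAt τ s p.2.2))
          ((A.slice τ s).leafDensity (lamAt τ s) p.1 (uAt τ s p.2.2)) p.2.1
      - gradSq (𝓡 n) (baseBasis n) ((A.slice τ s).metric (uAt τ s p.2.2))
          ((A.slice τ s).leafDensity (lamAt τ s) p.1 (uAt τ s p.2.2)) p.2.1
      + 2 * lamAt τ s *
        ((A.slice τ s).ambDensity (lamAt τ s) (p.1, p.2.1, uAt τ s p.2.2) - n)) := by
    simp only [totV₁, v₁, weightedScalar, Fintype.card_fin]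
    rfl
  have hn : (n : ℝ) / (2 * tauAt τ s) = n * lamAt τ s := div_eq_mul_inv _ _
  rw [hn]
  change (1 - (2 * τ)⁻¹ * p.2.2)⁻¹ * A.totV₁ τ (p, s) * -(1 - (2 * τ)⁻¹ * p.2.2) +
    -(1 - (2 * τ)⁻¹ * p.2.2) * (1 - s / τ)⁻¹ * A.densityDeriv (2 * τ)⁻¹ p = _
  linear_combination -(1 / 2) * hu - hv₁ - A.totV₁ τ (p, s) * inv_mul_cancel₀ hne

end IsGlobalAmbient

theorem one_sub_div_pos {τ s : ℝ} (hτ : 0 < τ) (hs : s < τ) : 0 < 1 - s / τ :=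
  sub_pos.mpr ((div_lt_one hτ).mpr hs)

end NormalSpace

end WeightedAmbient

end

open WeightedAmbient WeightedAmbient.NormalSpace in
theorem theorem1p9_general {n : ℕ} {M : Type*} [TopologicalSpace M]
    [ChartedSpace (EuclideanSpace ℝ (Fin n)) M] [IsManifold (𝓡 n) ∞ M]
    (A : NormalSpace n M) {τ : ℝ} (hτ : τ ≠ 0)
    (hA : A.IsGlobalAmbient (2 * τ)⁻¹) :
    (∀ s, 0 < 1 - s / τ → (A.slice τ s).IsGlobalAmbient (lamAt τ s)) ∧
    ∀ p ∈ A.carrier, ∀ s, 0 < 1 - s / τ →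
      (∀ X Z : TangentSpace (totI n) (p, s),
        lieTensor (totI n) (totBasis n) (A.flowField τ) (A.totMetric τ) (p, s) X Z =
          -2 * weightedRicci (𝓡 n) (baseBasis n) ((A.slice τ s).metric (uAt τ s p.2.2))
            ((A.slice τ s).leafDensity (lamAt τ s) p.1 (uAt τ s p.2.2)) p.2.1
            (dx n X.1) (dx n Z.1)) ∧
      lieFun (totI n) (A.flowField τ) (A.totDensity τ) (p, s) =
        -scalar (𝓡 n) (baseBasis n) ((A.slice τ s).metric (uAt τ s p.2.2)) p.2.1
          - laplacian (𝓡 n) (baseBasis n) ((A.slice τ s).metric (uAt τ s p.2.2))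
              ((A.slice τ s).leafDensity (lamAt τ s) p.1 (uAt τ s p.2.2)) p.2.1
          + n / (2 * tauAt τ s) ∧
      lieFun (totI n) (A.flowField τ) (totTau M τ) (p, s) = -1 :=
  ⟨fun _ hs => hA.slice hs, fun p hp s hs =>
    ⟨hA.lieTensor_totMetric hs hp, hA.lieFun_totDensity hs hp, A.lieFun_totTau hτ (p, s)⟩⟩

open WeightedAmbient WeightedAmbient.NormalSpace in
theorem theorem1p9 {n : ℕ} {M : Type*} [TopologicalSpace M]
    [ChartedSpace (EuclideanSpace ℝ (Fin n)) M] [IsManifold (𝓡 n) ∞ M]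
    (A : NormalSpace n M) {τ ε : ℝ} (hτ : 0 < τ) (hε : 0 < ε)
    (hA : A.IsGlobalAmbient (2 * τ)⁻¹) :
    (∀ s ∈ Set.Ioo (-ε) τ, (A.slice τ s).IsGlobalAmbient (lamAt τ s)) ∧
    ∀ p ∈ A.carrier, ∀ s ∈ Set.Ioo (-ε) τ,
      (∀ X Z : TangentSpace (totI n) (p, s),
        lieTensor (totI n) (totBasis n) (A.flowField τ) (A.totMetric τ) (p, s) X Z =
          -2 * weightedRicci (𝓡 n) (baseBasis n) ((A.slice τ s).metric (uAt τ s p.2.2))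
            ((A.slice τ s).leafDensity (lamAt τ s) p.1 (uAt τ s p.2.2)) p.2.1
            (dx n X.1) (dx n Z.1)) ∧
      lieFun (totI n) (A.flowField τ) (A.totDensity τ) (p, s) =
        -scalar (𝓡 n) (baseBasis n) ((A.slice τ s).metric (uAt τ s p.2.2)) p.2.1
          - laplacian (𝓡 n) (baseBasis n) ((A.slice τ s).metric (uAt τ s p.2.2))
              ((A.slice τ s).leafDensity (lamAt τ s) p.1 (uAt τ s p.2.2)) p.2.1
          + n / (2 * tauAt τ s) ∧
      lieFun (totI n) (A.flowField τ) (totTau M τ) (p, s) = -1 := by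
  have h := theorem1p9_general A hτ.ne' hA
  exact ⟨fun s hs => h.1 s (one_sub_div_pos hτ hs.2), fun p hp s hs =>
    h.2 p hp s (one_sub_div_pos hτ hs.2)⟩
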